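/- **Setting.** Let $(\Omega,\mathcal F,(\mathcal F_t)_{t\ge 0},\mathbb P)$ be a filtered probability space and $Z$ a standard Brownian motion relative to $(\mathcal F_t)$. Let $p\ge 1$, $q\ge 0$ be integers and let $\theta=(\omega_1,\omega_2,\gamma_1,\dots,\gamma_q,\alpha_1,\dots,\alpha_p,\nu)$ be real parameters with $\alpha_1\neq 0$; put $\omega=\omega_1-\omega_2$. An adapted process $\beta_t$, $t\ge 0$, with a.s. continuous paths is a *DR Beta diffusion process* with parameter $\theta$ if, almost surely, for all $t\ge 0$, $$\beta_t=\beta_{[t]}+(t-[t])^2\Big(\omega_1+\sum_{i=1}^q\gamma_i\beta_{[t]+1-i}+\sum_{i=2}^p\alpha_i I\beta_{[t]-i+2}\Big)-(t-[t])(\omega_2+\beta_{[t]})+\alpha_1\int_{[t]}^t\beta_s\,ds+\nu([t]+1-t)(Z_t-Z_{[t]}),$$ where $[t]$ is the integer part of $t$, $I\beta_k=\int_{k-1}^{k}\beta_s\,ds$, and the quantities $\beta_0,\dots,\beta_{-q+1}$ (always including $\beta_0$) and $I\beta_0=\int_{-1}^0\beta_s\,ds,\dots,I\beta_{2-p}=\int_{1-p}^{2-p}\beta_s\,ds$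 are given $\mathcal F_0$-measurable initial values. Put $$\varrho_1=\alpha_1^{-1}(e^{\alpha_1}-1),\quad \varrho_2=\alpha_1^{-2}(e^{\alpha_1}-1-\alpha_1),\quad \varrho_3=\alpha_1^{-3}\Big(e^{\alpha_1}-1-\alpha_1-\frac{\alpha_1^2}{2}\Big),$$ $$\omega^g=(\varrho_1-\varrho_2+2\varrho_3)\,\omega+(2\varrho_3-\varrho_2)\Big(1-\sum_{i=1}^q\gamma_i\Big)\omega_2,$$ $$\alpha_i^g=\mathbf 1_{\{i\le q\}}2\varrho_3\gamma_i\alpha_1+\mathbf 1_{\{i\le p\}}(\varrho_1-\varrho_2)\alpha_i+\mathbf 1_{\{i\le p-1\}}2\varrho_3\alpha_{i+1}.$$ The *state* at the integer time $n\ge 0$ is the vector $(\beta_n,\dots,\beta_{n-\max(q,1)+1},I\beta_n,\dots,I\beta_{n-p+2})$; at $n=0$ it consists of the initial values. The process is called *stationary* if the law of the state does not depend on $n$, and *stationary in mean* if the state is integrable and its mean does not depend on $n$. **Proposition.** Assume $\sum_{i=1}^q|\gamma_i|<1$ and $\sum_{i=1}^{p\vee q}\big|\mathbf 1_{\{i\le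 q\}}\gamma_i+\alpha_i^g\big|<1$. There is a constant $C>0$, depending only on $\theta$, $p$ and $q$, such that for every DR Beta diffusion process with parameter $\theta$ there are random variables $h_n$, $D_n$ $(n\ge 1)$ with the following properties. (a) For all $n\ge1$, $h_n$ is $\mathcal F_{n-1}$-measurable and $$I\beta_n=\int_{n-1}^n\beta_t\,dt=h_n+D_n\quad\text{a.s.},$$ $$D_n=\nu\int_{n-1}^n\Big[(n-t)\alpha_1^{-1}e^{\alpha_1(n-t)}-\alpha_1^{-2}e^{\alpha_1(n-t)}+\alpha_1^{-2}\Big]dZ_t\quad\text{a.s.}$$ (Wiener integral). The sequence $(D_n)$ is a martingale difference: $D_n$ is $\mathcal F_n$-measurable and integrable with $\mathbb E[D_n\mid\mathcal F_{n-1}]=0$ a.s. For every $n>\max(q,1)$, that is, whenever every $h$ and every $I\beta$ on the right-hand side is defined, $$h_n=\omega^g+\sum_{i=1}^q\gamma_i h_{n-i}+\sum_{i=1}^{p\vee q}\alpha_i^g I\beta_{n-i}\quad\text{a.s.}$$ (b) If all initial values have finite moments of every order, or if the process is stationary, then for all $n\ge1$ the variables $\beta_n$ and $I\beta_n$ have finite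 moments of every order, and $\mathbb E[I\beta_n\mid\mathcal F_{n-1}]=h_n$ a.s. If the process is stationary, or stationary in mean, then for all $n\ge 1$ the variables $h_n$ and $\beta_n$ are integrable and $$\mathbb E[h_n]=\frac{\omega^g}{1-\sum_{i=1}^q\gamma_i-\sum_{j=1}^{p\vee q}\alpha_j^g},\qquad \mathbb E[\beta_n]=\frac{\omega\big(1-\sum_{i=1}^q\gamma_i-\sum_{j=1}^{p\vee q}\alpha_j^g\big)+\omega^g\sum_{i=1}^p\alpha_i}{\big(1-\sum_{i=1}^q\gamma_i-\sum_{j=1}^{p\vee q}\alpha_j^g\big)\big(1-\sum_{i=1}^q\gamma_i\big)}.$$ (c) $D_n\in L^2$ for all $n\ge1$, and almost surely $\sup_{n\ge1}\mathbb E[D_n^2\mid\mathcal F_{n-1}]\le C$. -/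

import Mathlib

open MeasureTheory ProbabilityTheory Filter Set Finset
open scoped NNReal ENNReal Topology

noncomputable section

/-! ### Brownian motion relative to a filtration and the Wiener integral -/

/-- `Z` is a standard Brownian motion relative to the filtration `F`: it is a Brownian motion,
it is adapted, and its increments after time `s` are independent of `F s`. -/
structure IsFilteredBrownian {Ω : Type*} [mΩ : MeasurableSpace Ω] (P : Measure Ω)
    (F : Filtration ℝ≥0 mΩ) (Z : ℝ≥0 → Ω → ℝ) : Prop where
  brownian : IsBrownianReal Z P
  adapted : StronglyAdapted F Z
  indep : ∀ s t : ℝ≥0, s ≤ t →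
    Indep (MeasurableSpace.comap (fun ω => Z t ω - Z s ω) inferInstance) (F s) P

/-- A deterministic step function `∑ j, c j * 1_{(s j, t j]}` supported in `(a, b]`. -/
structure StepFn (a b : ℝ≥0) where
  N : ℕ
  c : Fin N → ℝ
  s : Fin N → ℝ≥0
  t : Fin N → ℝ≥0
  left_le : ∀ j, a ≤ s j
  le : ∀ j, s j ≤ t j
  le_right : ∀ j, t j ≤ b

/-- The value of a step function at `x`. -/
def StepFn.eval {a b : ℝ≥0} (φ : StepFn a b) (x : ℝ) : ℝ :=
  ∑ j, (Set.Ioc (φ.s j : ℝ) (φ.t j : ℝ)).indicator (fun _ => φ.c j) x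

/-- The Wiener integral `∑ j, c j * (Z (t j) - Z (s j))` of a step function. -/
def StepFn.integral {Ω : Type*} {a b : ℝ≥0} (φ : StepFn a b) (Z : ℝ≥0 → Ω → ℝ) (ω : Ω) : ℝ :=
  ∑ j, φ.c j * (Z (φ.t j) ω - Z (φ.s j) ω)

/-- `I` is (a version of) the Wiener integral `∫_a^b f(t) dZ_t` of the deterministic square
integrable function `f`: for some step functions `φ k → f` in `L²((a, b], dt)`, the integrals of
the `φ k` converge to `I` in `L²(P)`. -/
def IsWienerIntegral {Ω : Type*} [MeasurableSpace Ω] (P : Measure Ω) (Z : ℝ≥0 → Ω → ℝ)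
    (a b : ℝ≥0) (f : ℝ → ℝ) (I : Ω → ℝ) : Prop :=
  MemLp f 2 (volume.restrict (Set.Ioc (a : ℝ) (b : ℝ))) ∧ MemLp I 2 P ∧
  ∃ φ : ℕ → StepFn a b,
    Tendsto (fun k => eLpNorm (fun x => (φ k).eval x - f x) 2
      (volume.restrict (Set.Ioc (a : ℝ) (b : ℝ)))) atTop (𝓝 0) ∧
    Tendsto (fun k => eLpNorm (fun ω => (φ k).integral Z ω - I ω) 2 P) atTop (𝓝 0)

/-- `D 1, D 2, …` is a martingale difference sequence relative to `F 0 ⊆ F 1 ⊆ F 2 ⊆ …`. -/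
def IsMartingaleDifference {Ω : Type*} [mΩ : MeasurableSpace Ω] (P : Measure Ω)
    (F : Filtration ℝ≥0 mΩ) (D : ℕ → Ω → ℝ) : Prop :=
  ∀ n : ℕ, 1 ≤ n → StronglyMeasurable[F (n : ℝ≥0)] (D n) ∧ Integrable (D n) P ∧
    P[D n | F ((n - 1 : ℕ) : ℝ≥0)] =ᵐ[P] 0

/-! ### The model -/

/-- The parameter `θ = (ω₁, ω₂, γ₁, …, γ_q, α₁, …, α_p, ν)` together with the orders `p`, `q`.
Only `γ i` with `1 ≤ i ≤ q` and `α i` with `1 ≤ i ≤ p` matter. -/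
structure DRBetaParam where
  p : ℕ
  q : ℕ
  ω₁ : ℝ
  ω₂ : ℝ
  γ : ℕ → ℝ
  α : ℕ → ℝ
  ν : ℝ

namespace DRBetaParam

variable (θ : DRBetaParam)

/-- `ω = ω₁ - ω₂`. -/
def ω : ℝ := θ.ω₁ - θ.ω₂

/-- `ϱ₁ = α₁⁻¹ (e^{α₁} - 1)`. -/
def rho1 : ℝ := (θ.α 1)⁻¹ * (Real.exp (θ.α 1) - 1)

/-- `ϱ₂ = α₁⁻² (e^{α₁} - 1 - α₁)`. -/
def rho2 : ℝ := (θ.α 1 ^ 2)⁻¹ * (Real.exp (θ.α 1) - 1 - θ.α 1)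

/-- `ϱ₃ = α₁⁻³ (e^{α₁} - 1 - α₁ - α₁² / 2)`. -/
def rho3 : ℝ := (θ.α 1 ^ 3)⁻¹ * (Real.exp (θ.α 1) - 1 - θ.α 1 - θ.α 1 ^ 2 / 2)

/-- `ω^g`. -/
def omegaG : ℝ :=
  (θ.rho1 - θ.rho2 + 2 * θ.rho3) * θ.ω
    + (2 * θ.rho3 - θ.rho2) * (1 - ∑ i ∈ Finset.Icc 1 θ.q, θ.γ i) * θ.ω₂

/-- `α_i^g`. -/
def alphaG (i : ℕ) : ℝ :=
  (if i ≤ θ.q then 2 * θ.rho3 * θ.γ i * θ.α 1 else 0)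
    + (if i ≤ θ.p then (θ.rho1 - θ.rho2) * θ.α i else 0)
    + (if i + 1 ≤ θ.p then 2 * θ.rho3 * θ.α (i + 1) else 0)

/-- The integrand
`(n - t) α₁⁻¹ e^{α₁ (n - t)} - α₁⁻² e^{α₁ (n - t)} + α₁⁻²` of the martingale difference. -/
def kernel (n : ℕ) (t : ℝ) : ℝ :=
  ((n : ℝ) - t) * (θ.α 1)⁻¹ * Real.exp (θ.α 1 * ((n : ℝ) - t))
    - (θ.α 1 ^ 2)⁻¹ * Real.exp (θ.α 1 * ((n : ℝ) - t)) + (θ.α 1 ^ 2)⁻¹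

end DRBetaParam

/-- The spot beta `β_k` at an integer time `k`: the value of the process for `k ≥ 0` and the
initial value `b₀ k` for `k < 0`. -/
def spotBeta {Ω : Type*} (β : ℝ≥0 → Ω → ℝ) (b₀ : ℤ → Ω → ℝ) (k : ℤ) (ω : Ω) : ℝ :=
  if 0 ≤ k then β (k.toNat : ℝ≥0) ω else b₀ k ω

/-- The integrated beta `Iβ_k = ∫_{k-1}^k β_s ds`: the integral of the path for `k ≥ 1` and the
initial value `J₀ k` for `k ≤ 0`. -/
def intBeta {Ω : Type*} (β : ℝ≥0 → Ω → ℝ) (J₀ : ℤ → Ω → ℝ) (k : ℤ) (ω : Ω) : ℝ :=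
  if 1 ≤ k then ∫ s in ((k : ℝ) - 1)..(k : ℝ), β s.toNNReal ω else J₀ k ω

/-- `β` is a DR Beta diffusion process with parameter `θ`, driven by `Z`, with initial values
`β_0` (the value of `β` at time `0`), `β_{-1} = b₀ (-1)`, …, `β_{-q+1} = b₀ (-q+1)`,
`∫_{-1}^0 β_s ds = J₀ 0`, …, `∫_{1-p}^{2-p} β_s ds = J₀ (2-p)`. The other values of `b₀`, `J₀` are
irrelevant. -/
structure IsDRBetaDiffusion {Ω : Type*} [mΩ : MeasurableSpace Ω] (θ : DRBetaParam)
    (P : Measure Ω) (F : Filtration ℝ≥0 mΩ) (Z : ℝ≥0 → Ω → ℝ)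
    (β : ℝ≥0 → Ω → ℝ) (b₀ J₀ : ℤ → Ω → ℝ) : Prop where
  adapted : StronglyAdapted F β
  continuous : ∀ᵐ ω ∂P, Continuous (fun t => β t ω)
  measurable_b₀ : ∀ k : ℤ, 1 - (θ.q : ℤ) ≤ k → k < 0 → StronglyMeasurable[F 0] (b₀ k)
  measurable_J₀ : ∀ k : ℤ, 2 - (θ.p : ℤ) ≤ k → k ≤ 0 → StronglyMeasurable[F 0] (J₀ k)
  eq : ∀ᵐ ω ∂P, ∀ t : ℝ≥0, ∀ n : ℕ, n = ⌊t⌋₊ →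
    β t ω = β (n : ℝ≥0) ω
      + ((t : ℝ) - n) ^ 2 *
        (θ.ω₁ + ∑ i ∈ Finset.Icc 1 θ.q, θ.γ i * spotBeta β b₀ ((n : ℤ) + 1 - i) ω
          + ∑ i ∈ Finset.Icc 2 θ.p, θ.α i * intBeta β J₀ ((n : ℤ) - i + 2) ω)
      - ((t : ℝ) - n) * (θ.ω₂ + β (n : ℝ≥0) ω)
      + θ.α 1 * (∫ s in (n : ℝ)..(t : ℝ), β s.toNNReal ω)
      + θ.ν * ((n : ℝ) + 1 - t) * (Z t ω - Z (n : ℝ≥0) ω)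

/-- All initial values have finite moments of every order. -/
def InitialMoments {Ω : Type*} [MeasurableSpace Ω] (θ : DRBetaParam) (P : Measure Ω)
    (β : ℝ≥0 → Ω → ℝ) (b₀ J₀ : ℤ → Ω → ℝ) : Prop :=
  ∀ r : ℝ≥0, MemLp (β 0) r P ∧
    (∀ k : ℤ, 1 - (θ.q : ℤ) ≤ k → k < 0 → MemLp (b₀ k) r P) ∧
    (∀ k : ℤ, 2 - (θ.p : ℤ) ≤ k → k ≤ 0 → MemLp (J₀ k) r P)

/-- The state at the integer time `n`: the spot betas `β_n, …, β_{n-q+1}` (always at least `β_n`)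
and the integrated betas `Iβ_n, …, Iβ_{n-p+2}`. At `n = 0` these are the initial values. -/
def drState {Ω : Type*} (θ : DRBetaParam) (β : ℝ≥0 → Ω → ℝ) (b₀ J₀ : ℤ → Ω → ℝ) (n : ℕ) (ω : Ω) :
    (Fin (max θ.q 1) → ℝ) × (Fin (θ.p - 1) → ℝ) :=
  (fun i => spotBeta β b₀ ((n : ℤ) - (i : ℕ)) ω, fun i => intBeta β J₀ ((n : ℤ) - (i : ℕ)) ω)

/-- The process is strictly stationary along the integers: the joint law of the state does not
depend on time (the state is a Markov chain). -/
def IsStationaryDR {Ω : Type*} [MeasurableSpace Ω] (θ : DRBetaParam) (P : Measure Ω)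
    (β : ℝ≥0 → Ω → ℝ) (b₀ J₀ : ℤ → Ω → ℝ) : Prop :=
  ∀ n : ℕ, IdentDistrib (drState θ β b₀ J₀ n) (drState θ β b₀ J₀ 0) P P

/-- The process is stationary in mean along the integers: the state is integrable and its mean
does not depend on time. -/
def IsMeanStationaryDR {Ω : Type*} [MeasurableSpace Ω] (θ : DRBetaParam) (P : Measure Ω)
    (β : ℝ≥0 → Ω → ℝ) (b₀ J₀ : ℤ → Ω → ℝ) : Prop :=
  ∀ n : ℕ, Integrable (drState θ β b₀ J₀ n) P ∧
    ∫ ω, drState θ β b₀ J₀ n ω ∂P = ∫ ω, drState θ β b₀ J₀ 0 ω ∂P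

end

/-! On each interval `[n, n + 1]` the primitive `X` of the path solves a linear equation `X' = α₁ X
+ (quadratic in t - n) + ν (n + 1 - t) (Z_t - Z_n)`. Variation of constants (`integral_path`) gives
`Iβ_{n+1}` as an affine function of the state at time `n` (`prediction`) plus `ν ∫ (n + 1 - u) e^{α₁
(n + 1 - u)} (Z_u - Z_n) du` (`noise`). Minus the weight is the derivative of `kernel`, which
vanishes at `n + 1`, so summation by parts identifies this pathwise integral with the Wiener
integral of `kernel`. Letting `t → n + 1` in the dynamics gives `β_{n+1}` (`path_end`). Almost every
path thus yields a deterministic linear system with inputs, `IsSolution`, and the recursion for `h`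
is algebra in that system (`prediction_eq`).

Independence of Brownian increments from the past makes the noise a martingale difference.
Minkowski's integral inequality bounds its `L^r` norms uniformly in `n` and, applied to `P`
restricted to a past event, its conditional second moment.

Given moments of the initial values, moments propagate by induction. In the stationary case no
moment is assumed: the process is compared with the solution started from zero with the same
innovations. Their difference solves the homogeneous system and tends to zero almost surely by the
two contraction hypotheses, while the zero solution is bounded in every `L^r`, `r ≥ 1`. Since the
law does not change with time, truncation and Fatou carry that bound over to the initial values
(`memLp_of_identDistrib_add`). The means then solve two scalar linear equations. -/

/-! ### Time integrals of continuous processes through Riemann sums -/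

/-- The sum of left endpoint values over `m + 1` equal cells approximates the integral. -/
theorem tendsto_riemannSum {f : ℝ → ℝ} (hf : Continuous f) {a b : ℝ} (hab : a ≤ b) :
    Tendsto (fun m : ℕ => (b - a) / (m + 1) *
      ∑ j ∈ Finset.range (m + 1), f (a + j * ((b - a) / (m + 1)))) atTop
      (𝓝 (∫ s in a..b, f s)) := by
  rw [Metric.tendsto_atTop]
  intro ε hε
  have huc := (isCompact_Icc (a := a) (b := b)).uniformContinuousOn_of_continuous hf.continuousOn
  rw [Metric.uniformContinuousOn_iff] at huc
  -- The `+ 1` avoids division by zero when `a = b` and makes the final bound `ε (b - a) / (b - a +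
  -- 1)` strictly less than `ε`.
  obtain ⟨δ, hδ, hfδ⟩ := huc (ε / (b - a + 1)) (by have := sub_nonneg.2 hab; positivity)
  obtain ⟨N, hN⟩ := exists_nat_gt ((b - a) / δ)
  refine ⟨N, fun m hm => ?_⟩
  have hm1 : (0 : ℝ) < m + 1 := by positivity
  set w : ℝ := (b - a) / (m + 1) with hw
  have hw0 : 0 ≤ w := div_nonneg (sub_nonneg.2 hab) hm1.le
  have hwδ : w < δ := by
    rw [hw, div_lt_iff₀ hm1]
    rw [div_lt_iff₀ hδ] at hN
    have : (N : ℝ) ≤ m := by exact_mod_cast hm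
    nlinarith
  have hmw : ((m : ℝ) + 1) * w = b - a := by rw [hw]; field_simp
  have hint : ∀ x y : ℝ, IntervalIntegrable f volume x y := fun x y => hf.intervalIntegrable x y
  have hsplit : ∫ s in a..b, f s
      = ∑ j ∈ Finset.range (m + 1), ∫ s in (a + j * w)..(a + (j + 1 : ℕ) * w), f s := by
    rw [intervalIntegral.sum_integral_adjacent_intervals (a := fun j : ℕ => a + j * w)
      (fun k _ => hint _ _)]
    congr 1
    · simp
    · push_cast; linarith
  have hcell : ∀ j ∈ Finset.range (m + 1),
      ‖w * f (a + j * w) - ∫ s in (a + j * w)..(a + (j + 1 : ℕ) * w), f s‖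
        ≤ ε / (b - a + 1) * w := by
    intro j hj
    have hj' : ((j : ℝ) + 1) ≤ m + 1 := by
      have := Finset.mem_range.1 hj
      exact_mod_cast this
    have hconst : w * f (a + j * w) = ∫ s in (a + j * w)..(a + (j + 1 : ℕ) * w), f (a + j * w) := by
      rw [intervalIntegral.integral_const]
      push_cast
      rw [smul_eq_mul]
      ring
    rw [hconst, ← intervalIntegral.integral_sub intervalIntegrable_const (hint _ _)]
    refine (intervalIntegral.norm_integral_le_of_norm_le_const (C := ε / (b - a + 1))
      fun s hs => ?_).trans_eq ?_
    · have hle : a + j * w ≤ a + (j + 1 : ℕ) * w := by push_cast; nlinarith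
      rw [Set.uIoc_of_le hle] at hs
      obtain ⟨h1, h2⟩ := hs
      push_cast at h2
      have hjw : ((j : ℝ) + 1) * w ≤ b - a := by rw [← hmw]; gcongr
      have hjw0 : 0 ≤ (j : ℝ) * w := by positivity
      rw [← dist_eq_norm]
      refine (hfδ _ ⟨by linarith, by linarith⟩ _ ⟨by linarith, by linarith⟩ ?_).le
      rw [Real.dist_eq, abs_lt]
      constructor <;> linarith
    · congr 1
      push_cast
      rw [show a + ((j : ℝ) + 1) * w - (a + j * w) = w by ring, abs_of_nonneg hw0]
  rw [dist_eq_norm, Finset.mul_sum, hsplit, ← Finset.sum_sub_distrib]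
  calc _ ≤ ∑ j ∈ Finset.range (m + 1), ε / (b - a + 1) * w := norm_sum_le_of_le _ hcell
    _ = ε * ((b - a) / (b - a + 1)) := by
        rw [Finset.sum_const, Finset.card_range, nsmul_eq_mul]
        push_cast
        rw [show ((m : ℝ) + 1) * (ε / (b - a + 1) * w) = ε / (b - a + 1) * ((m + 1) * w) by ring, hmw]
        ring
    _ < ε := by
        have h1 : 0 ≤ b - a := sub_nonneg.2 hab
        have : (b - a) / (b - a + 1) < 1 := by rw [div_lt_one (by linarith)]; linarith
        nlinarith

/-- The time integral of a process with continuous paths has a version measurable with respect to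
any `σ`-algebra that makes the values of the process measurable. -/
theorem exists_stronglyMeasurable_integral {Ω : Type*} {m mΩ : MeasurableSpace Ω}
    {μ : Measure Ω} {Y : ℝ → Ω → ℝ} {a b : ℝ} (hab : a ≤ b)
    (hc : ∀ᵐ ω ∂μ, Continuous fun u => Y u ω) (hm : ∀ u ≤ b, Measurable[m] (Y u)) :
    ∃ J : Ω → ℝ, StronglyMeasurable[m] J ∧ J =ᵐ[μ] fun ω => ∫ u in a..b, Y u ω := by
  -- A limsup of Riemann sums is measurable for `m` without any convergence; an almost sure limit
  -- need not be, as `m` may lack null sets.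
  refine ⟨fun ω => limsup (fun k : ℕ => (b - a) / (k + 1) *
      ∑ j ∈ Finset.range (k + 1), Y (a + j * ((b - a) / (k + 1))) ω) atTop, ?_, ?_⟩
  · refine Measurable.stronglyMeasurable (Measurable.limsup fun k => ?_)
    refine Measurable.const_mul (Finset.measurable_fun_sum _ fun j hj => hm _ ?_) _
    have hj' : (j : ℝ) ≤ k + 1 := by
      have := (Finset.mem_range.1 hj).le
      exact_mod_cast this
    have hk : (0 : ℝ) < k + 1 := by positivity
    have : (j : ℝ) * ((b - a) / (k + 1)) ≤ (k + 1) * ((b - a) / (k + 1)) :=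
      mul_le_mul_of_nonneg_right hj' (div_nonneg (sub_nonneg.2 hab) hk.le)
    rw [mul_div_cancel₀ _ hk.ne'] at this
    linarith
  · filter_upwards [hc] with ω hω
    exact (tendsto_riemannSum hω hab).limsup_eq

/-- **Minkowski's integral inequality** for a process with continuous paths. -/
theorem eLpNorm_integral_le_of_continuous {Ω : Type*} {mΩ : MeasurableSpace Ω}
    {μ : Measure Ω} {Y : ℝ → Ω → ℝ} {a b : ℝ} (hab : a ≤ b) {r : ℝ≥0∞} (hr : 1 ≤ r)
    (hc : ∀ᵐ ω ∂μ, Continuous fun u => Y u ω) (hm : ∀ u, AEStronglyMeasurable (Y u) μ)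
    {M : ℝ≥0∞} (hM : ∀ u ∈ Set.Icc a b, eLpNorm (Y u) r μ ≤ M) :
    eLpNorm (fun ω => ∫ u in a..b, Y u ω) r μ ≤ ENNReal.ofReal (b - a) * M := by
  -- Fatou's lemma reduces the claim to Riemann sums, where the triangle inequality suffices.
  refine Lp.eLpNorm_le_of_ae_tendsto (u := atTop)
    (f := fun (k : ℕ) ω => (b - a) / (k + 1) *
      ∑ j ∈ Finset.range (k + 1), Y (a + j * ((b - a) / (k + 1))) ω)
    (Eventually.of_forall fun k => ?_) (fun k => ?_) ?_
  · have hk : (0 : ℝ) < k + 1 := by positivity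
    have hw0 : 0 ≤ (b - a) / (k + 1 : ℝ) := div_nonneg (sub_nonneg.2 hab) hk.le
    have hle : ∀ j ∈ Finset.range (k + 1),
        eLpNorm (Y (a + j * ((b - a) / (k + 1)))) r μ ≤ M := by
      intro j hj
      refine hM _ ⟨by nlinarith [mul_nonneg (Nat.cast_nonneg (α := ℝ) j) hw0], ?_⟩
      have hj' : (j : ℝ) ≤ k + 1 := by
        have := (Finset.mem_range.1 hj).le
        exact_mod_cast this
      have : (j : ℝ) * ((b - a) / (k + 1)) ≤ (k + 1) * ((b - a) / (k + 1)) :=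
        mul_le_mul_of_nonneg_right hj' hw0
      rw [mul_div_cancel₀ _ hk.ne'] at this
      linarith
    have h1 : eLpNorm (fun ω => ∑ j ∈ Finset.range (k + 1), Y (a + j * ((b - a) / (k + 1))) ω) r μ
        ≤ (k + 1 : ℕ) * M := by
      have h2 := (eLpNorm_sum_le (s := Finset.range (k + 1)) (p := r) (μ := μ)
        (f := fun j : ℕ => Y (a + j * ((b - a) / (k + 1)))) (fun j _ => hm _) hr).trans
        (Finset.sum_le_sum hle)
      rw [Finset.sum_const, Finset.card_range, nsmul_eq_mul] at h2
      convert! h2 using 2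
      ext ω
      simp
    calc _ = ‖(b - a) / (k + 1 : ℝ)‖ₑ * eLpNorm (fun ω => ∑ j ∈ Finset.range (k + 1),
              Y (a + j * ((b - a) / (k + 1))) ω) r μ :=
            eLpNorm_const_smul ((b - a) / (k + 1 : ℝ)) _ r μ
      _ ≤ ENNReal.ofReal ((b - a) / (k + 1)) * ((k + 1 : ℕ) * M) := by
            rw [Real.enorm_of_nonneg hw0]
            gcongr
      _ = ENNReal.ofReal (b - a) * M := by
            rw [← mul_assoc, ← ENNReal.ofReal_natCast, ← ENNReal.ofReal_mul hw0]
            congr 2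
            push_cast
            field_simp
  · exact (Finset.aestronglyMeasurable_fun_sum _ fun j _ => hm _).const_mul _
  · filter_upwards [hc] with ω hω
    exact tendsto_riemannSum hω hab

theorem MeasureTheory.MemLp.eLpNorm_two_eq_sqrt {α : Type*} {mα : MeasurableSpace α}
    {μ : Measure α} {f : α → ℝ} (hf : MemLp f 2 μ) :
    eLpNorm f 2 μ = ENNReal.ofReal √(∫ x, f x ^ 2 ∂μ) := by
  rw [hf.eLpNorm_eq_integral_rpow_norm (by simp) (by simp), Real.sqrt_eq_rpow]
  simp

/-- A bound for the integrals over the sets of a `σ`-algebra bounds the conditional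
expectation. -/
theorem condExp_le_const_of_setIntegral_le {Ω : Type*} {m mΩ : MeasurableSpace Ω}
    {μ : Measure Ω} [IsFiniteMeasure μ] (hm : m ≤ mΩ) {f : Ω → ℝ} (hf : Integrable f μ) {c : ℝ}
    (h : ∀ A, MeasurableSet[m] A → ∫ x in A, f x ∂μ ≤ c * μ.real A) :
    ∀ᵐ x ∂μ, (μ[f | m]) x ≤ c := by
  refine ae_le_of_ae_le_trim (hm := hm) (ae_le_of_forall_setIntegral_le
    (integrable_condExp.trim hm stronglyMeasurable_condExp) (integrable_const c) ?_)
  intro A hA _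
  rw [← setIntegral_trim hm stronglyMeasurable_condExp hA, setIntegral_condExp hm hf hA,
    setIntegral_const, measureReal_def, trim_measurableSet_eq hm hA, ← measureReal_def,
    smul_eq_mul, mul_comm]
  exact h A hA

/-! ### Brownian increments and past events -/

section Increments

variable {Ω : Type*} [mΩ : MeasurableSpace Ω] {P : Measure Ω} {F : Filtration ℝ≥0 mΩ}
  {Z : ℝ≥0 → Ω → ℝ}

/-- The `L^r` norm of a Brownian increment scales like the square root of its length. -/
theorem ProbabilityTheory.IsPreBrownianReal.eLpNorm_sub (hZ : IsPreBrownianReal Z P) (r : ℝ≥0∞)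
    {s t : ℝ≥0} (hst : s ≤ t) :
    eLpNorm (Z t - Z s) r P
      = ENNReal.ofReal √((t : ℝ) - s) * eLpNorm id r (gaussianReal 0 1) := by
  have hlaw := hZ.hasLaw_sub t s
  have h0 : (0 : ℝ) ≤ (t : ℝ) - s := sub_nonneg.2 (by exact_mod_cast hst)
  have hv : (gaussianReal 0 1).map (√((t : ℝ) - s) * ·) = gaussianReal 0 (nndist t.1 s.1) := by
    rw [gaussianReal_map_const_mul]
    congr 1
    · simp
    · ext
      simp only [mul_one, NNReal.coe_mk, coe_nndist, Real.dist_eq]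
      rw [Real.sq_sqrt h0]
      exact (abs_of_nonneg h0).symm
  calc eLpNorm (Z t - Z s) r P = eLpNorm id r (P.map (Z t - Z s)) :=
        (eLpNorm_map_measure aestronglyMeasurable_id hlaw.aemeasurable).symm
    _ = eLpNorm (fun x => √((t : ℝ) - s) * x) r (gaussianReal 0 1) := by
        rw [hlaw.map_eq, ← hv, eLpNorm_map_measure aestronglyMeasurable_id
          (measurable_const_mul _).aemeasurable]
        rfl
    _ = _ := by
        rw [show (fun x : ℝ => √((t : ℝ) - s) * x) = √((t : ℝ) - s) • (id : ℝ → ℝ) from rfl,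
          eLpNorm_const_smul, Real.enorm_of_nonneg (Real.sqrt_nonneg _)]

theorem ProbabilityTheory.IsPreBrownianReal.memLp_sub (hZ : IsPreBrownianReal Z P) (r : ℝ≥0)
    {s t : ℝ≥0} (hst : s ≤ t) : MemLp (Z t - Z s) r P := by
  refine ⟨((hZ.aemeasurable t).sub (hZ.aemeasurable s)).aestronglyMeasurable, ?_⟩
  rw [hZ.eLpNorm_sub r hst]
  exact ENNReal.mul_lt_top ENNReal.ofReal_lt_top (memLp_id_gaussianReal r).2

theorem IsFilteredBrownian.setIntegral_sub (hZ : IsFilteredBrownian P F Z) {s t : ℝ≥0}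
    (hst : s ≤ t) {A : Set Ω} (hA : MeasurableSet[F s] A) :
    ∫ ω in A, (Z t ω - Z s ω) ∂P = 0 := by
  have hm := (hZ.brownian.aemeasurable t).sub (hZ.brownian.aemeasurable s)
  have h := (hZ.indep s t hst).symm.setIntegral_eq_mul (F.le s) (f := id) hm hA
    aestronglyMeasurable_id
  simp only [id] at h
  rw [h, integral_sub (hZ.brownian.integrable_eval t) (hZ.brownian.integrable_eval s),
    hZ.brownian.integral_eval, hZ.brownian.integral_eval]
  simp

theorem IsFilteredBrownian.setIntegral_sub_sq (hZ : IsFilteredBrownian P F Z) {s t : ℝ≥0}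
    (hst : s ≤ t) {A : Set Ω} (hA : MeasurableSet[F s] A) :
    ∫ ω in A, (Z t ω - Z s ω) ^ 2 ∂P = P.real A * ((t : ℝ) - s) := by
  have hlaw := hZ.brownian.hasLaw_sub t s
  have hm := (hZ.brownian.aemeasurable t).sub (hZ.brownian.aemeasurable s)
  have h := (hZ.indep s t hst).symm.setIntegral_eq_mul (F.le s) (f := fun x => x ^ 2) hm hA
    (by fun_prop)
  have h0 : (0 : ℝ) ≤ (t : ℝ) - s := sub_nonneg.2 (by exact_mod_cast hst)
  have hvar : Var[Z t - Z s; P] = (t : ℝ) - s := by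
    rw [hlaw.variance_eq, variance_id_gaussianReal, coe_nndist, Real.dist_eq]
    exact abs_of_nonneg h0
  have hint : ∫ ω, (Z t - Z s) ω ∂P = 0 := by
    have := hZ.setIntegral_sub hst (A := Set.univ) MeasurableSet.univ
    rwa [Measure.restrict_univ] at this
  rw [variance_of_integral_eq_zero (by exact hm) hint] at hvar
  rw [h]
  congr 1

/-- Independence factors the second moment over a past event. This is what makes the noise estimates
conditional. -/
theorem IsFilteredBrownian.eLpNorm_sub_restrict (hZ : IsFilteredBrownian P F Z) {s t : ℝ≥0}
    (hst : s ≤ t) {A : Set Ω} (hA : MeasurableSet[F s] A) :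
    eLpNorm (Z t - Z s) 2 (P.restrict A) = ENNReal.ofReal √(P.real A * ((t : ℝ) - s)) := by
  rw [((hZ.brownian.memLp_sub 2 hst).restrict A).eLpNorm_two_eq_sqrt]
  simp only [Pi.sub_apply]
  rw [hZ.setIntegral_sub_sq hst hA]

end Increments

/-! ### The kernel and its derivative -/

namespace DRBetaParam

variable (θ : DRBetaParam)

/-- Minus the derivative of `θ.kernel n`. -/
noncomputable def density (n : ℕ) (t : ℝ) : ℝ :=
  ((n : ℝ) - t) * Real.exp (θ.α 1 * ((n : ℝ) - t))

theorem continuous_density (n : ℕ) : Continuous (θ.density n) := by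
  unfold density; fun_prop

theorem hasDerivAt_kernel (hα : θ.α 1 ≠ 0) (n : ℕ) (t : ℝ) :
    HasDerivAt (θ.kernel n) (-θ.density n t) t := by
  have h1 : HasDerivAt (fun t : ℝ => (n : ℝ) - t) (-1) t := by
    simpa using (hasDerivAt_id t).const_sub (n : ℝ)
  have h2 : HasDerivAt (fun t : ℝ => Real.exp (θ.α 1 * ((n : ℝ) - t)))
      (Real.exp (θ.α 1 * ((n : ℝ) - t)) * (θ.α 1 * -1)) t := (h1.const_mul (θ.α 1)).exp
  have h3 := (((h1.mul_const (θ.α 1)⁻¹).mul h2).sub (h2.const_mul (θ.α 1 ^ 2)⁻¹)).add_const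
    ((θ.α 1 ^ 2)⁻¹)
  refine h3.congr_deriv ?_
  unfold density
  field_simp
  ring

theorem kernel_self (n : ℕ) : θ.kernel n n = 0 := by
  simp [kernel]

theorem continuous_kernel (n : ℕ) : Continuous (θ.kernel n) := by
  unfold kernel; fun_prop

theorem abs_density_le {n : ℕ} {t : ℝ} (ht : t ∈ Set.Icc ((n : ℝ) - 1) n) :
    |θ.density n t| ≤ Real.exp |θ.α 1| := by
  obtain ⟨h1, h2⟩ := ht
  have h3 : 0 ≤ (n : ℝ) - t := by linarith
  have h4 : (n : ℝ) - t ≤ 1 := by linarith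
  rw [density, abs_of_nonneg (by positivity)]
  have h5 : Real.exp (θ.α 1 * ((n : ℝ) - t)) ≤ Real.exp |θ.α 1| := by
    apply Real.exp_le_exp.2
    calc θ.α 1 * ((n : ℝ) - t) ≤ |θ.α 1| * ((n : ℝ) - t) :=
          mul_le_mul_of_nonneg_right (le_abs_self _) h3
      _ ≤ |θ.α 1| := mul_le_of_le_one_right (abs_nonneg _) h4
  calc _ ≤ 1 * Real.exp |θ.α 1| := mul_le_mul h4 h5 (Real.exp_pos _).le zero_le_one
    _ = _ := one_mul _

/-- Mean value inequality. The Lipschitz constant gives the rate of the step function approximation,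
and a bound on the kernel itself through its zero at `n`. -/
theorem abs_kernel_sub_le (hα : θ.α 1 ≠ 0) {n : ℕ} {s t : ℝ} (hs : s ∈ Set.Icc ((n : ℝ) - 1) n)
    (ht : t ∈ Set.Icc ((n : ℝ) - 1) n) :
    |θ.kernel n t - θ.kernel n s| ≤ Real.exp |θ.α 1| * |t - s| :=
  (convex_Icc _ _).norm_image_sub_le_of_norm_hasDerivWithin_le
    (fun x _ => (θ.hasDerivAt_kernel hα n x).hasDerivWithinAt)
    (fun x hx => by rw [norm_neg]; exact θ.abs_density_le hx) hs ht

end DRBetaParam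

/-! ### Summation by parts and step functions on a uniform grid -/

/-- Summation by parts against a path `z`. -/
theorem integral_mul_sub_eq_sum {K g z : ℝ → ℝ} (hK : ∀ t, HasDerivAt K (-g t) t)
    (hg : Continuous g) (hz : Continuous z) (τ : ℕ → ℝ) (N : ℕ) :
    ∫ u in (τ 0)..(τ N), g u * (z u - z (τ 0))
      = ∑ j ∈ Finset.range N, (K (τ (j + 1)) * (z (τ (j + 1)) - z (τ j))
          + ∫ u in (τ j)..(τ (j + 1)), g u * (z u - z (τ j)))
        - K (τ N) * (z (τ N) - z (τ 0)) := by
  have hint : ∀ c x y, IntervalIntegrable (fun u => g u * (z u - c)) volume x y :=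
    fun c x y => (by fun_prop : Continuous fun u => g u * (z u - c)).intervalIntegrable x y
  induction N with
  | zero => simp
  | succ N ih =>
    have hgi : ∫ u in (τ N)..(τ (N + 1)), g u = K (τ N) - K (τ (N + 1)) := by
      rw [intervalIntegral.integral_eq_sub_of_hasDerivAt (f := fun t => -K t)
        (fun t _ => (hK t).neg.congr_deriv (neg_neg _)) (hg.intervalIntegrable _ _)]
      ring
    -- Rebasing the increment from `τ 0` to `τ N` leaves a constant times the integral of `g`, that
    -- is, times a drop of `K`.
    have hcell : ∫ u in (τ N)..(τ (N + 1)), g u * (z u - z (τ 0))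
        = (∫ u in (τ N)..(τ (N + 1)), g u * (z u - z (τ N)))
          + (K (τ N) - K (τ (N + 1))) * (z (τ N) - z (τ 0)) := by
      rw [← hgi, ← intervalIntegral.integral_mul_const,
        ← intervalIntegral.integral_add (hint _ _ _)
          ((hg.intervalIntegrable _ _).mul_const _)]
      refine intervalIntegral.integral_congr fun u _ => ?_
      ring
    rw [← intervalIntegral.integral_add_adjacent_intervals (hint _ _ (τ N)) (hint _ _ _), ih,
      Finset.sum_range_succ, hcell]
    ring

/-- The grid dividing `[n, n + 1]` into `m + 1` equal cells. -/
noncomputable def unitGrid (n m j : ℕ) : ℝ≥0 := n + j * ((m : ℝ≥0) + 1)⁻¹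

theorem unitGrid_zero (n m : ℕ) : unitGrid n m 0 = n := by simp [unitGrid]

theorem unitGrid_last (n m : ℕ) : unitGrid n m (m + 1) = (n + 1 : ℕ) := by
  have : ((m : ℝ≥0) + 1) ≠ 0 := by positivity
  simp [unitGrid, this]

theorem unitGrid_mono (n m : ℕ) : Monotone (unitGrid n m) := by
  intro i j hij
  unfold unitGrid
  gcongr

theorem unitGrid_step (n m j : ℕ) :
    (unitGrid n m (j + 1) : ℝ) - unitGrid n m j = ((m : ℝ) + 1)⁻¹ := by
  simp only [unitGrid]
  push_cast
  ring

theorem le_unitGrid (n m j : ℕ) : (n : ℝ≥0) ≤ unitGrid n m j := by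
  simp [unitGrid]

theorem unitGrid_le {n m j : ℕ} (hj : j ≤ m + 1) : unitGrid n m j ≤ (n + 1 : ℕ) := by
  rw [← unitGrid_last n m]
  exact unitGrid_mono n m hj

/-- The cell of the grid that contains a given point. -/
theorem exists_mem_unitGrid_cell {n m : ℕ} {x : ℝ} (hx : x ∈ Set.Ioc (n : ℝ) (n + 1 : ℕ)) :
    ∃ j < m + 1, x ∈ Set.Ioc (unitGrid n m j : ℝ) (unitGrid n m (j + 1)) := by
  have hex : ∃ j, x ≤ unitGrid n m (j + 1) := ⟨m, by rw [unitGrid_last]; exact_mod_cast hx.2⟩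
  classical
  refine ⟨Nat.find hex, ?_, ?_, Nat.find_spec hex⟩
  · exact Nat.lt_succ_of_le (Nat.find_le (by rw [unitGrid_last]; exact_mod_cast hx.2))
  · rcases Nat.eq_zero_or_pos (Nat.find hex) with h0 | h0
    · rw [h0, unitGrid_zero]
      exact_mod_cast hx.1
    · have := Nat.find_min hex (m := Nat.find hex - 1) (by omega)
      rwa [Nat.sub_add_cancel h0, not_le] at this

namespace DRBetaParam

variable (θ : DRBetaParam)

/-- The step function with the value of the kernel at the right end of each cell. -/
noncomputable def kernelStep (n m : ℕ) : StepFn (n : ℝ≥0) ((n + 1 : ℕ) : ℝ≥0) where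
  N := m + 1
  c j := θ.kernel (n + 1) (unitGrid n m (j + 1))
  s j := unitGrid n m j
  t j := unitGrid n m (j + 1)
  left_le j := le_unitGrid n m j
  le _ := unitGrid_mono n m (Nat.le_succ _)
  le_right j := unitGrid_le j.2

theorem abs_kernelStep_eval_sub_le (hα : θ.α 1 ≠ 0) {n m : ℕ} {x : ℝ}
    (hx : x ∈ Set.Ioc (n : ℝ) (n + 1 : ℕ)) :
    |(θ.kernelStep n m).eval x - θ.kernel (n + 1) x| ≤ Real.exp |θ.α 1| * ((m : ℝ) + 1)⁻¹ := by
  obtain ⟨j, hj, hxj⟩ := exists_mem_unitGrid_cell (m := m) hx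
  have heval : (θ.kernelStep n m).eval x = θ.kernel (n + 1) (unitGrid n m (j + 1)) := by
    unfold StepFn.eval kernelStep
    rw [Finset.sum_eq_single ⟨j, hj⟩]
    · simp only
      rw [Set.indicator_of_mem hxj]
    · intro i _ hij
      refine Set.indicator_of_notMem (fun hxi => hij ?_) _
      ext
      refine le_antisymm ?_ ?_ <;> by_contra hlt <;> rw [not_le] at hlt
      · have : (unitGrid n m (j + 1) : ℝ) ≤ unitGrid n m i := by
          exact_mod_cast unitGrid_mono n m hlt
        linarith [hxi.1, hxj.2]
      · have : (unitGrid n m (i + 1) : ℝ) ≤ unitGrid n m j := by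
          exact_mod_cast unitGrid_mono n m hlt
        linarith [hxi.2, hxj.1]
    · simp
  have hstep := unitGrid_step n m j
  have hle : (unitGrid n m (j + 1) : ℝ) ≤ (n + 1 : ℕ) := by exact_mod_cast unitGrid_le hj
  have hx1 := hx.1
  have hx2 := hx.2
  have hxj1 := hxj.1
  have hxj2 := hxj.2
  push_cast at hx2 hle
  rw [heval]
  refine (θ.abs_kernel_sub_le hα (n := n + 1) ⟨?_, ?_⟩ ⟨?_, ?_⟩).trans ?_
  · push_cast; linarith
  · push_cast; linarith
  · push_cast; linarith
  · push_cast; linarith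
  · gcongr
    rw [abs_of_nonneg] <;> linarith

end DRBetaParam

/-! ### The noise: Wiener integral, moments, conditional expectation -/

namespace DRBetaParam

/-- The pathwise form of the Wiener integral of `θ.kernel (n + 1)` over `(n, n + 1]`. -/
noncomputable def noise (θ : DRBetaParam) {Ω : Type*} (Z : ℝ≥0 → Ω → ℝ) (n : ℕ) (ω : Ω) : ℝ :=
  ∫ u in (n : ℝ)..(n + 1 : ℕ), θ.density (n + 1) u * (Z u.toNNReal ω - Z n ω)

variable (θ : DRBetaParam) {Ω : Type*} {Z : ℝ≥0 → Ω → ℝ}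

theorem kernelStep_integral (n m : ℕ) (ω : Ω) :
    (θ.kernelStep n m).integral Z ω = ∑ j ∈ Finset.range (m + 1),
      θ.kernel (n + 1) (unitGrid n m (j + 1)) *
        (Z (unitGrid n m (j + 1)) ω - Z (unitGrid n m j) ω) :=
  Fin.sum_univ_eq_sum_range (fun j => θ.kernel (n + 1) (unitGrid n m (j + 1)) *
    (Z (unitGrid n m (j + 1)) ω - Z (unitGrid n m j) ω)) (m + 1)

/-- Summation by parts along the grid samples the kernel at right ends of cells, exactly as
`kernelStep` does, and its boundary term is zero because the kernel vanishes at `n + 1`. Only the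
oscillation of `Z` within the cells remains. -/
theorem noise_sub_kernelStep_integral (hα : θ.α 1 ≠ 0) (n m : ℕ) {ω : Ω}
    (hω : Continuous fun t => Z t ω) :
    θ.noise Z n ω - (θ.kernelStep n m).integral Z ω = ∑ j ∈ Finset.range (m + 1),
      ∫ u in (unitGrid n m j : ℝ)..(unitGrid n m (j + 1)),
        θ.density (n + 1) u * (Z u.toNNReal ω - Z (unitGrid n m j) ω) := by
  have h := integral_mul_sub_eq_sum (θ.hasDerivAt_kernel hα (n + 1)) (θ.continuous_density (n + 1))
    (hω.comp continuous_real_toNNReal) (fun j => (unitGrid n m j : ℝ)) (m + 1)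
  simp only [Function.comp_apply, Real.toNNReal_coe, unitGrid_zero, unitGrid_last,
    NNReal.coe_natCast, Real.toNNReal_natCast, kernel_self, zero_mul, sub_zero, Finset.sum_add_distrib] at h
  rw [noise, h, θ.kernelStep_integral, add_sub_cancel_left]

variable [mΩ : MeasurableSpace Ω] {P : Measure Ω} {F : Filtration ℝ≥0 mΩ}

/-- Minkowski's integral inequality with the bound on the density. The measure is left free so that
`P` restricted to a past event is allowed. -/
theorem eLpNorm_integral_density_le (hZ : IsBrownianReal Z P) {μ : Measure Ω} (hμ : μ ≪ P)
    {n : ℕ} {x y : ℝ} (hnx : (n : ℝ) ≤ x) (hxy : x ≤ y) (hyn : y ≤ (n + 1 : ℕ)) (c : ℝ≥0)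
    {r : ℝ≥0∞} (hr : 1 ≤ r) {M : ℝ≥0∞}
    (hM : ∀ u ∈ Set.Icc x y, eLpNorm (Z u.toNNReal - Z c) r μ ≤ M) :
    eLpNorm (fun ω => ∫ u in x..y, θ.density (n + 1) u * (Z u.toNNReal ω - Z c ω)) r μ
      ≤ ENNReal.ofReal (y - x) * (ENNReal.ofReal (Real.exp |θ.α 1|) * M) := by
  refine eLpNorm_integral_le_of_continuous hxy hr ?_ ?_ ?_
  · filter_upwards [hμ.ae_le hZ.cont] with ω hω
    exact (θ.continuous_density _).mul
      ((hω.comp continuous_real_toNNReal).sub continuous_const)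
  · intro u
    exact (((hZ.aemeasurable _).sub (hZ.aemeasurable _)).mono_ac hμ).aestronglyMeasurable.const_mul _
  · intro u hu
    have hd : |θ.density (n + 1) u| ≤ Real.exp |θ.α 1| := by
      refine θ.abs_density_le ⟨?_, hu.2.trans hyn⟩
      push_cast
      linarith [hu.1]
    calc eLpNorm (fun ω => θ.density (n + 1) u * (Z u.toNNReal ω - Z c ω)) r μ
        = ‖θ.density (n + 1) u‖ₑ * eLpNorm (Z u.toNNReal - Z c) r μ :=
          eLpNorm_const_smul (θ.density (n + 1) u) (Z u.toNNReal - Z c) r μ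
      _ ≤ _ := by
          rw [← ofReal_norm]
          gcongr
          · exact hd
          · exact hM u hu

theorem _root_.NNReal.natCast_le_toNNReal {n : ℕ} {u : ℝ} (h : (n : ℝ) ≤ u) :
    (n : ℝ≥0) ≤ u.toNNReal := by
  simpa using Real.toNNReal_le_toNNReal h

theorem aestronglyMeasurable_noise (hZ : IsBrownianReal Z P) (n : ℕ) :
    AEStronglyMeasurable (θ.noise Z n) P := by
  have hmk : ∀ᵐ ω ∂P, Continuous fun u : ℝ => θ.density (n + 1) u *
      (Z u.toNNReal ω - Z n ω) := by
    filter_upwards [hZ.cont] with ω hω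
    exact (θ.continuous_density _).mul
      ((hω.comp continuous_real_toNNReal).sub continuous_const)
  have hn : (n : ℝ) ≤ (n + 1 : ℕ) := by push_cast; linarith
  refine aestronglyMeasurable_of_tendsto_ae atTop (fun k => ?_) (by
    filter_upwards [hmk] with ω hω
    exact tendsto_riemannSum hω hn)
  exact (Finset.aestronglyMeasurable_fun_sum _ fun j _ =>
    ((hZ.aemeasurable _).sub (hZ.aemeasurable _)).aestronglyMeasurable.const_mul _).const_mul _

theorem eLpNorm_noise_le (hZ : IsBrownianReal Z P) {r : ℝ≥0} (hr : 1 ≤ r) (n : ℕ) :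
    eLpNorm (θ.noise Z n) r P
      ≤ ENNReal.ofReal (Real.exp |θ.α 1|) * eLpNorm id r (gaussianReal 0 1) := by
  have hn : (n : ℝ) ≤ (n + 1 : ℕ) := by push_cast; linarith
  refine (θ.eLpNorm_integral_density_le hZ Measure.AbsolutelyContinuous.rfl le_rfl hn le_rfl n
    (by exact_mod_cast hr) (M := eLpNorm id r (gaussianReal 0 1)) fun u hu => ?_).trans_eq ?_
  · rw [hZ.eLpNorm_sub r (NNReal.natCast_le_toNNReal hu.1)]
    refine mul_le_of_le_one_left zero_le ?_
    rw [ENNReal.ofReal_le_one, ← Real.sqrt_one]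
    refine Real.sqrt_le_sqrt ?_
    rw [Real.coe_toNNReal _ (n.cast_nonneg.trans hu.1)]
    have := hu.2
    push_cast at this ⊢
    linarith
  · push_cast
    simp

theorem memLp_noise [IsProbabilityMeasure P] (hZ : IsBrownianReal Z P) (r : ℝ≥0) (n : ℕ) :
    MemLp (θ.noise Z n) r P := by
  -- Minkowski needs an exponent at least `1`; smaller exponents follow because `P` is finite.
  have h : MemLp (θ.noise Z n) ((max r 1 : ℝ≥0) : ℝ≥0∞) P :=
    ⟨θ.aestronglyMeasurable_noise hZ n,
      (θ.eLpNorm_noise_le hZ (le_max_right r 1) n).trans_lt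
        (ENNReal.mul_lt_top ENNReal.ofReal_lt_top (memLp_id_gaussianReal _).2)⟩
  exact h.mono_exponent (by exact_mod_cast le_max_left r 1)

/-- The conditional second moment of the noise, tested on sets of the past. -/
theorem setIntegral_noise_sq_le [IsProbabilityMeasure P] (hZ : IsFilteredBrownian P F Z) (n : ℕ)
    {A : Set Ω} (hA : MeasurableSet[F (n : ℝ≥0)] A) :
    ∫ ω in A, θ.noise Z n ω ^ 2 ∂P ≤ Real.exp |θ.α 1| ^ 2 * P.real A := by
  have hn : (n : ℝ) ≤ (n + 1 : ℕ) := by push_cast; linarith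
  have h := θ.eLpNorm_integral_density_le hZ.brownian (μ := P.restrict A)
    Measure.restrict_le_self.absolutelyContinuous le_rfl hn le_rfl n (r := 2) (by norm_num)
    (M := ENNReal.ofReal √(P.real A)) fun u hu => ?_
  · change eLpNorm (θ.noise Z n) 2 (P.restrict A) ≤ _ at h
    rw [((θ.memLp_noise hZ.brownian 2 n).restrict A).eLpNorm_two_eq_sqrt,
      ← ENNReal.ofReal_mul (Real.exp_pos _).le, ← ENNReal.ofReal_mul (sub_nonneg.2 hn),
      ENNReal.ofReal_le_ofReal_iff (by have := sub_nonneg.2 hn; positivity)] at h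
    have hone : ((n + 1 : ℕ) : ℝ) - n = 1 := by push_cast; ring
    rw [hone, one_mul] at h
    have h2 := pow_le_pow_left₀ (Real.sqrt_nonneg _) h 2
    rwa [Real.sq_sqrt (integral_nonneg fun _ => sq_nonneg _), mul_pow,
      Real.sq_sqrt measureReal_nonneg] at h2
  · rw [hZ.eLpNorm_sub_restrict (NNReal.natCast_le_toNNReal hu.1) hA]
    refine ENNReal.ofReal_le_ofReal (Real.sqrt_le_sqrt ?_)
    rw [Real.coe_toNNReal _ (n.cast_nonneg.trans hu.1)]
    refine mul_le_of_le_one_right measureReal_nonneg ?_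
    have := hu.2
    push_cast at this ⊢
    linarith

/-- With cells of length `w = 1 / (m + 1)`, an increment of `Z` inside a cell has `L²` norm at most
`√w`, so each cell contributes at most `w e^{|α₁|} √w`. The triangle inequality over the `m + 1`
cells gives the rate. -/
theorem eLpNorm_kernelStep_integral_sub_le [IsProbabilityMeasure P] (hα : θ.α 1 ≠ 0)
    (hZ : IsFilteredBrownian P F Z) (n m : ℕ) :
    eLpNorm (fun ω => (θ.kernelStep n m).integral Z ω - θ.noise Z n ω) 2 P
      ≤ ENNReal.ofReal (Real.exp |θ.α 1| * √((m : ℝ) + 1)⁻¹) := by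
  have hm0 : (0 : ℝ) < m + 1 := by positivity
  have hcell : ∀ j ∈ Finset.range (m + 1),
      eLpNorm (fun ω => ∫ u in (unitGrid n m j : ℝ)..(unitGrid n m (j + 1)),
        θ.density (n + 1) u * (Z u.toNNReal ω - Z (unitGrid n m j) ω)) 2 P
      ≤ ENNReal.ofReal (((m : ℝ) + 1)⁻¹ * (Real.exp |θ.α 1| * √((m : ℝ) + 1)⁻¹)) := by
    intro j hj
    have hstep := unitGrid_step n m j
    refine (θ.eLpNorm_integral_density_le hZ.brownian Measure.AbsolutelyContinuous.rfl (n := n)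
      (by exact_mod_cast le_unitGrid n m j) (by exact_mod_cast unitGrid_mono n m (Nat.le_succ j))
      (by exact_mod_cast unitGrid_le (Finset.mem_range.1 hj)) _ (by norm_num)
      (M := ENNReal.ofReal √((m : ℝ) + 1)⁻¹) fun u hu => ?_).trans_eq ?_
    · have hle : unitGrid n m j ≤ u.toNNReal := by
        simpa using Real.toNNReal_le_toNNReal hu.1
      have := hZ.eLpNorm_sub_restrict hle (A := Set.univ) MeasurableSet.univ
      rw [Measure.restrict_univ] at this
      rw [this]
      refine ENNReal.ofReal_le_ofReal (Real.sqrt_le_sqrt ?_)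
      rw [Real.coe_toNNReal _ ((unitGrid n m j).2.trans hu.1)]
      simp only [probReal_univ, one_mul]
      linarith [hu.2]
    · rw [hstep, ← ENNReal.ofReal_mul (Real.exp_pos _).le, ← ENNReal.ofReal_mul (by positivity)]
  have hmeas : ∀ j, AEStronglyMeasurable
      (fun ω => ∫ u in (unitGrid n m j : ℝ)..(unitGrid n m (j + 1)),
        θ.density (n + 1) u * (Z u.toNNReal ω - Z (unitGrid n m j) ω)) P := by
    intro j
    refine aestronglyMeasurable_of_tendsto_ae atTop (fun k => ?_) (by
      filter_upwards [hZ.brownian.cont] with ω hω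
      exact tendsto_riemannSum ((θ.continuous_density _).mul
        ((hω.comp continuous_real_toNNReal).sub continuous_const))
        (by exact_mod_cast unitGrid_mono n m (Nat.le_succ j)))
    exact (Finset.aestronglyMeasurable_fun_sum _ fun j _ =>
      ((hZ.brownian.aemeasurable _).sub
        (hZ.brownian.aemeasurable _)).aestronglyMeasurable.const_mul _).const_mul _
  have heq : (fun ω => (θ.kernelStep n m).integral Z ω - θ.noise Z n ω) =ᵐ[P]
      -(∑ j ∈ Finset.range (m + 1), fun ω =>
        ∫ u in (unitGrid n m j : ℝ)..(unitGrid n m (j + 1)),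
        θ.density (n + 1) u * (Z u.toNNReal ω - Z (unitGrid n m j) ω)) := by
    filter_upwards [hZ.brownian.cont] with ω hω
    rw [← neg_sub, θ.noise_sub_kernelStep_integral hα n m hω]
    simp
  rw [eLpNorm_congr_ae heq, eLpNorm_neg]
  refine ((eLpNorm_sum_le (fun j _ => hmeas j) (by norm_num)).trans
    (Finset.sum_le_sum hcell)).trans_eq ?_
  rw [Finset.sum_const, Finset.card_range, nsmul_eq_mul, ← ENNReal.ofReal_natCast,
    ← ENNReal.ofReal_mul (by positivity)]
  congr 1
  push_cast
  field_simp

theorem tendsto_ofReal_mul_sqrt_inv (c : ℝ) :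
    Tendsto (fun m : ℕ => ENNReal.ofReal (c * √((m : ℝ) + 1)⁻¹)) atTop (𝓝 0) := by
  have h1 : Tendsto (fun m : ℕ => ((m : ℝ) + 1)⁻¹) atTop (𝓝 0) := by
    simpa using tendsto_one_div_add_atTop_nhds_zero_nat (𝕜 := ℝ)
  have h2 := (h1.sqrt.const_mul c)
  simp only [Real.sqrt_zero, mul_zero] at h2
  simpa using ENNReal.tendsto_ofReal h2

theorem isWienerIntegral_noise [IsProbabilityMeasure P] (hα : θ.α 1 ≠ 0)
    (hZ : IsFilteredBrownian P F Z) (n : ℕ) :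
    IsWienerIntegral P Z (n : ℝ≥0) ((n + 1 : ℕ) : ℝ≥0) (θ.kernel (n + 1)) (θ.noise Z n) := by
  refine ⟨?_, θ.memLp_noise hZ.brownian 2 n, θ.kernelStep n, ?_, ?_⟩
  · simp only [NNReal.coe_natCast]
    refine MemLp.of_bound (C := Real.exp |θ.α 1|)
      (θ.continuous_kernel _).aestronglyMeasurable ?_
    refine (ae_restrict_iff' measurableSet_Ioc).2 (ae_of_all _ fun x hx => ?_)
    obtain ⟨h1, h2⟩ := hx
    have h := θ.abs_kernel_sub_le hα (n := n + 1) (s := (n + 1 : ℕ)) (t := x)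
      (by constructor <;> push_cast <;> linarith) ⟨by push_cast; linarith, h2⟩
    rw [kernel_self, sub_zero] at h
    refine h.trans (mul_le_of_le_one_right (Real.exp_pos _).le ?_)
    push_cast at h2 ⊢
    rw [abs_le]
    constructor <;> linarith
  · simp only [NNReal.coe_natCast]
    have h1 : Tendsto (fun m : ℕ => ENNReal.ofReal (Real.exp |θ.α 1| * ((m : ℝ) + 1)⁻¹)) atTop
        (𝓝 0) := by
      have h1 : Tendsto (fun m : ℕ => ((m : ℝ) + 1)⁻¹) atTop (𝓝 0) := by
        simpa using tendsto_one_div_add_atTop_nhds_zero_nat (𝕜 := ℝ)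
      simpa using ENNReal.tendsto_ofReal (h1.const_mul (Real.exp |θ.α 1|))
    refine tendsto_of_tendsto_of_tendsto_of_le_of_le tendsto_const_nhds h1 (fun _ => zero_le)
      fun m => ?_
    refine (eLpNorm_le_of_ae_bound ((ae_restrict_iff' measurableSet_Ioc).2
      (ae_of_all _ fun x hx => θ.abs_kernelStep_eval_sub_le hα (m := m) hx))).trans ?_
    simp
  · exact tendsto_of_tendsto_of_tendsto_of_le_of_le tendsto_const_nhds
      (tendsto_ofReal_mul_sqrt_inv _) (fun _ => zero_le)
      fun m => θ.eLpNorm_kernelStep_integral_sub_le hα hZ n m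

/-- The noise has mean zero on sets of the past. -/
theorem setIntegral_noise [IsProbabilityMeasure P] (hα : θ.α 1 ≠ 0)
    (hZ : IsFilteredBrownian P F Z) (n : ℕ) {A : Set Ω} (hA : MeasurableSet[F (n : ℝ≥0)] A) :
    ∫ ω in A, θ.noise Z n ω ∂P = 0 := by
  have hincr : ∀ m j, Integrable (fun ω => θ.kernel (n + 1) (unitGrid n m (j + 1)) *
        (Z (unitGrid n m (j + 1)) ω - Z (unitGrid n m j) ω)) P := fun m j =>
    ((hZ.brownian.integrable_eval _).sub (hZ.brownian.integrable_eval _)).const_mul _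
  have hint : ∀ m, Integrable ((θ.kernelStep n m).integral Z) P := fun m => by
    simp_rw [funext fun ω => θ.kernelStep_integral (Z := Z) n m ω]
    exact integrable_finsetSum _ fun j _ => hincr m j
  have hstep : ∀ m, ∫ ω in A, (θ.kernelStep n m).integral Z ω ∂P = 0 := fun m => by
    simp_rw [θ.kernelStep_integral]
    rw [integral_finsetSum _ fun j _ => (hincr m j).integrableOn]
    refine Finset.sum_eq_zero fun j _ => ?_
    rw [integral_const_mul, hZ.setIntegral_sub (unitGrid_mono n m (Nat.le_succ j))
      (F.mono (le_unitGrid n m j) A hA), mul_zero]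
  have hmeas := θ.aestronglyMeasurable_noise hZ.brownian n
  -- The `L²` rate implies `L¹` convergence, so the zero integrals of the step approximations over
  -- `A` pass to the limit.
  have hlim := tendsto_setIntegral_of_L1' _ hmeas
    (Eventually.of_forall hint) (l := atTop) (tendsto_of_tendsto_of_tendsto_of_le_of_le
      tendsto_const_nhds (tendsto_ofReal_mul_sqrt_inv (Real.exp |θ.α 1|)) (fun _ => zero_le)
      fun m => (eLpNorm_le_eLpNorm_of_exponent_le (by norm_num)
        ((hint m).aestronglyMeasurable.sub hmeas)).trans
          (θ.eLpNorm_kernelStep_integral_sub_le hα hZ n m)) A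
  simp only [hstep] at hlim
  exact (tendsto_nhds_unique hlim tendsto_const_nhds)

theorem condExp_noise [IsProbabilityMeasure P] (hα : θ.α 1 ≠ 0)
    (hZ : IsFilteredBrownian P F Z) (n : ℕ) : P[θ.noise Z n | F (n : ℝ≥0)] =ᵐ[P] 0 := by
  refine (ae_eq_condExp_of_forall_setIntegral_eq (F.le _)
    ((θ.memLp_noise hZ.brownian 1 n).integrable le_rfl) (fun _ _ _ => integrableOn_zero)
    (fun A hA _ => ?_) aestronglyMeasurable_zero).symm
  rw [θ.setIntegral_noise hα hZ n hA]
  simp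

end DRBetaParam

/-! ### The discrete time dynamics -/

namespace DRBetaParam

variable (θ : DRBetaParam)

/-- The coefficient of `(t - n) ^ 2` in the dynamics on `[n, n + 1]`, for spot betas `b` and
integrated betas `I`. -/
noncomputable def drift (b I : ℤ → ℝ) (n : ℤ) : ℝ :=
  θ.ω₁ + ∑ i ∈ Finset.Icc 1 θ.q, θ.γ i * b (n + 1 - i)
    + ∑ i ∈ Finset.Icc 2 θ.p, θ.α i * I (n - i + 2)

/-- The prediction of `I (n + 1)` at time `n`. -/
noncomputable def prediction (b I : ℤ → ℝ) (n : ℤ) : ℝ :=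
  (θ.rho1 - θ.rho2) * b n + 2 * θ.rho3 * θ.drift b I n - θ.rho2 * θ.ω₂

/-- `b` and `I` solve the discrete time dynamics with innovations `d`. -/
structure IsSolution (b I : ℤ → ℝ) (d : ℕ → ℝ) : Prop where
  spot : ∀ n : ℕ, b (n + 1 : ℤ) = θ.drift b I n - θ.ω₂ + θ.α 1 * I (n + 1 : ℤ)
  int : ∀ n : ℕ, I (n + 1 : ℤ) = θ.prediction b I n + d n

/-- The value at `n + 1` of a path that follows the dynamics on `[n, n + 1)`. -/
theorem path_end {f z : ℝ → ℝ} (hf : Continuous f) (hz : Continuous z) {n : ℕ} {b A : ℝ}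
    (h : ∀ t ∈ Set.Ico (n : ℝ) (n + 1 : ℕ), f t = b + (t - n) ^ 2 * A - (t - n) * (θ.ω₂ + b)
      + θ.α 1 * (∫ s in (n : ℝ)..t, f s) + θ.ν * (n + 1 - t) * (z t - z n)) :
    f (n + 1 : ℕ) = A - θ.ω₂ + θ.α 1 * ∫ s in (n : ℝ)..(n + 1 : ℕ), f s := by
  have hI : Continuous fun t => ∫ s in (n : ℝ)..t, f s :=
    intervalIntegral.continuous_primitive (fun x y => hf.intervalIntegrable x y) _
  -- The dynamics hold only on the half-open interval, since the integer part jumps at `n + 1`; both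
  -- sides are continuous, so equality extends to the endpoint, where the noise factor is zero.
  have hcl := Set.EqOn.closure (s := Set.Ico (n : ℝ) (n + 1 : ℕ)) h hf (by fun_prop)
  rw [closure_Ico (by push_cast; linarith)] at hcl
  have := hcl (Set.right_mem_Icc.2 (by push_cast; linarith))
  simp only at this
  rw [this]
  push_cast
  ring

/-- Variation of constants: the integral over `[n, n + 1]` of a path that follows the dynamics. -/
theorem integral_path {f z : ℝ → ℝ} (hα : θ.α 1 ≠ 0) (hf : Continuous f) (hz : Continuous z)
    {n : ℕ} {b A : ℝ}
    (h : ∀ t ∈ Set.Ico (n : ℝ) (n + 1 : ℕ), f t = b + (t - n) ^ 2 * A - (t - n) * (θ.ω₂ + b)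
      + θ.α 1 * (∫ s in (n : ℝ)..t, f s) + θ.ν * (n + 1 - t) * (z t - z n)) :
    ∫ s in (n : ℝ)..(n + 1 : ℕ), f s
      = (θ.rho1 - θ.rho2) * b + 2 * θ.rho3 * A - θ.rho2 * θ.ω₂
        + θ.ν * ∫ u in (n : ℝ)..(n + 1 : ℕ), θ.density (n + 1) u * (z u - z n) := by
  set a := θ.α 1 with ha
  set X : ℝ → ℝ := fun t => ∫ s in (n : ℝ)..t, f s with hX
  -- The coefficients are chosen so that `p(t) = p₀ + p₁ (t - n) + p₂ (t - n)²` has `a p - p'` equal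
  -- to the polynomial forcing. Then `X + p` solves the equation with the noise term alone, and
  -- `e^{a (n + 1 - t)} (X + p)` has derivative `ν` times the density times `z t - z n`.
  set p₂ : ℝ := A / a with hp₂
  set p₁ : ℝ := (2 * p₂ - θ.ω₂ - b) / a with hp₁
  set p₀ : ℝ := (p₁ + b) / a with hp₀
  have hE : ∀ t, HasDerivAt (fun t : ℝ => Real.exp (a * (((n + 1 : ℕ) : ℝ) - t)))
      (Real.exp (a * (((n + 1 : ℕ) : ℝ) - t)) * (a * -1)) t := fun t => by
    have h1 : HasDerivAt (fun t : ℝ => ((n + 1 : ℕ) : ℝ) - t) (-1) t := by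
      simpa using (hasDerivAt_id t).const_sub ((n + 1 : ℕ) : ℝ)
    exact (h1.const_mul a).exp
  have hXd : ∀ t, HasDerivAt X (f t) t := fun t => hf.integral_hasStrictDerivAt _ _ |>.hasDerivAt
  have hPd : ∀ t, HasDerivAt (fun t : ℝ => p₀ + p₁ * (t - n) + p₂ * (t - n) ^ 2)
      (p₁ + p₂ * (2 * (t - n))) t := fun t => by
    have h1 : HasDerivAt (fun t : ℝ => t - (n : ℝ)) 1 t := (hasDerivAt_id t).sub_const _
    refine (((h1.const_mul p₁).const_add p₀).add ((h1.pow 2).const_mul p₂)).congr_deriv ?_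
    simp
  have hG := fun t => (hE t).mul ((hXd t).add (hPd t))
  have hn : (n : ℝ) ≤ (n + 1 : ℕ) := by push_cast; linarith
  have hcont : Continuous fun u => θ.density (n + 1) u * (z u - z n) :=
    (θ.continuous_density _).mul (hz.sub continuous_const)
  have hFTC := intervalIntegral.integral_eq_sub_of_hasDerivAt_of_le hn
    (f' := fun u => θ.ν * (θ.density (n + 1) u * (z u - z n)))
    (fun t _ => (hG t).continuousAt.continuousWithinAt) (fun t ht => ?_)
    ((hcont.const_mul θ.ν).intervalIntegrable _ _)
  · rw [intervalIntegral.integral_const_mul] at hFTC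
    have hX0 : X n = 0 := intervalIntegral.integral_same
    simp only [Pi.mul_apply, Pi.add_apply, hX0] at hFTC
    change X (n + 1 : ℕ) = _
    rw [hFTC]
    push_cast
    have he : a * ((n : ℝ) + 1 - n) = a := by ring
    rw [he, hp₀, hp₁, hp₂, rho1, rho2, rho3, ← ha]
    simp only [sub_self, mul_zero, Real.exp_zero]
    field_simp
    ring
  · refine (hG t).congr_deriv ?_
    rw [h t ⟨ht.1.le, ht.2⟩, density, ← ha]
    have hq0 : a * p₀ = p₁ + b := by rw [hp₀]; field_simp
    have hq1 : a * p₁ = 2 * p₂ - θ.ω₂ - b := by rw [hp₁]; field_simp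
    have hq2 : a * p₂ = A := by rw [hp₂]; field_simp
    change Real.exp (a * (((n + 1 : ℕ) : ℝ) - t)) * (a * -1) *
      (X t + (p₀ + p₁ * (t - n) + p₂ * (t - n) ^ 2)) + Real.exp (a * (((n + 1 : ℕ) : ℝ) - t)) *
      (b + (t - n) ^ 2 * A - (t - n) * (θ.ω₂ + b) + a * X t + θ.ν * (n + 1 - t) * (z t - z n) +
      (p₁ + p₂ * (2 * (t - n)))) = _
    push_cast
    linear_combination (-Real.exp (a * ((n : ℝ) + 1 - t))) * (hq0 + (t - n) * hq1 +
      (t - n) ^ 2 * hq2)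

theorem sum_Icc_ite_le (f : ℕ → ℝ) {k M : ℕ} (h : k ≤ M) :
    ∑ i ∈ Finset.Icc 1 M, (if i ≤ k then f i else 0) = ∑ i ∈ Finset.Icc 1 k, f i := by
  rw [← Finset.sum_filter]
  congr 1
  ext i
  simp only [Finset.mem_filter, Finset.mem_Icc]
  omega

/-- The three terms of `alphaG` stop at `q`, `p` and `p - 1`. Zero padding puts them on a common
range, and the last is a shift of a sum starting at `2`. -/
theorem sum_alphaG_mul (hp : 1 ≤ θ.p) (x : ℕ → ℝ) :
    ∑ i ∈ Finset.Icc 1 (max θ.p θ.q), θ.alphaG i * x i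
      = 2 * θ.rho3 * θ.α 1 * ∑ i ∈ Finset.Icc 1 θ.q, θ.γ i * x i
        + (θ.rho1 - θ.rho2) * ∑ i ∈ Finset.Icc 1 θ.p, θ.α i * x i
        + 2 * θ.rho3 * ∑ i ∈ Finset.Icc 2 θ.p, θ.α i * x (i - 1) := by
  have h3 : ∑ i ∈ Finset.Icc 2 θ.p, θ.α i * x (i - 1)
      = ∑ i ∈ Finset.Icc 1 (θ.p - 1), θ.α (i + 1) * x i := by
    refine Finset.sum_bij' (fun i _ => i - 1) (fun i _ => i + 1) ?_ ?_ ?_ ?_ ?_ <;>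
      simp only [Finset.mem_Icc] <;> intro i hi
    · omega
    · omega
    · omega
    · omega
    · rw [Nat.sub_add_cancel (by omega)]
  rw [h3, Finset.mul_sum, Finset.mul_sum, Finset.mul_sum,
    ← sum_Icc_ite_le _ (le_max_right θ.p θ.q), ← sum_Icc_ite_le _ (le_max_left θ.p θ.q),
    ← sum_Icc_ite_le _ (show θ.p - 1 ≤ max θ.p θ.q from (Nat.sub_le _ _).trans (le_max_left _ _)),
    ← Finset.sum_add_distrib, ← Finset.sum_add_distrib]
  refine Finset.sum_congr rfl fun i _ => ?_
  have hiff : i + 1 ≤ θ.p ↔ i ≤ θ.p - 1 := by omega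
  simp only [alphaG, hiff]
  split_ifs <;> ring

theorem sum_alpha_eq (hp : 1 ≤ θ.p) (x : ℕ → ℝ) :
    ∑ i ∈ Finset.Icc 1 θ.p, θ.α i * x i
      = θ.α 1 * x 1 + ∑ i ∈ Finset.Icc 2 θ.p, θ.α i * x i := by
  rw [← Finset.add_sum_Ioc_eq_sum_Icc hp]
  rfl

namespace IsSolution

variable {θ} {b I : ℤ → ℝ} {d : ℕ → ℝ}

/-- The term `α₁ I (n + 1)` left at the endpoint is the missing `i = 1` term of the sum over `α`. -/
theorem spot_eq (h : θ.IsSolution b I d) (hp : 1 ≤ θ.p) (n : ℕ) :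
    b (n + 1 : ℤ) = θ.ω + ∑ i ∈ Finset.Icc 1 θ.q, θ.γ i * b (n + 1 - i : ℤ)
      + ∑ i ∈ Finset.Icc 1 θ.p, θ.α i * I (n + 2 - i : ℤ) := by
  rw [h.spot n, θ.sum_alpha_eq hp, drift, ω]
  have h1 : ((n : ℤ) + 2 - (1 : ℕ)) = n + 1 := by push_cast; ring
  have h2 : ∀ i : ℕ, ((n : ℤ) + 2 - i) = n - i + 2 := fun i => by ring
  simp only [h1, h2]
  ring

/-- The recursion for the predictions. -/
theorem prediction_eq (h : θ.IsSolution b I d) (hp : 1 ≤ θ.p) {n : ℕ} (hn : max θ.q 1 ≤ n) :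
    θ.prediction b I n = θ.omegaG
      + ∑ i ∈ Finset.Icc 1 θ.q, θ.γ i * θ.prediction b I (n - i : ℤ)
      + ∑ i ∈ Finset.Icc 1 (max θ.p θ.q), θ.alphaG i * I (n + 1 - i : ℤ) := by
  -- The current spot beta `b n` is itself expanded by the spot equation, which requires `n ≥ 1`.
  obtain ⟨k, rfl⟩ : ∃ k, n = k + 1 := ⟨n - 1, by have := le_max_right θ.q 1; omega⟩
  have hq : θ.q ≤ k + 1 := (le_max_left _ _).trans hn
  have hspot := h.spot_eq hp k
  -- The spot equation at `j = n - i ≥ 0` eliminates the past drift: it equals `b (j + 1) + ω₂ - α₁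
  -- I (j + 1)`. The correction in `I` is the source of the `γ i * α 1` term of `alphaG`.
  have hpast : ∑ i ∈ Finset.Icc 1 θ.q, θ.γ i * θ.prediction b I ((k + 1 : ℕ) - i : ℤ)
      = (θ.rho1 - θ.rho2) * ∑ i ∈ Finset.Icc 1 θ.q, θ.γ i * b ((k : ℤ) + 1 - i)
        + 2 * θ.rho3 * (∑ i ∈ Finset.Icc 1 θ.q, θ.γ i * b ((k + 1 : ℕ) + 1 - i : ℤ)
          + θ.ω₂ * ∑ i ∈ Finset.Icc 1 θ.q, θ.γ i
          - θ.α 1 * ∑ i ∈ Finset.Icc 1 θ.q, θ.γ i * I ((k + 1 : ℕ) + 1 - i : ℤ))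
        - θ.rho2 * θ.ω₂ * ∑ i ∈ Finset.Icc 1 θ.q, θ.γ i := by
    simp only [Finset.mul_sum, ← Finset.sum_add_distrib, ← Finset.sum_sub_distrib]
    refine Finset.sum_congr rfl fun i hi => ?_
    obtain ⟨hi1, hi2⟩ := Finset.mem_Icc.1 hi
    obtain ⟨j, hj⟩ : ∃ j : ℕ, j + i = k + 1 := ⟨k + 1 - i, by omega⟩
    have e1 : (((k + 1 : ℕ) : ℤ) - i) = (j : ℤ) := by omega
    have e2 : (((k + 1 : ℕ) : ℤ) + 1 - i) = (j : ℤ) + 1 := by omega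
    have e3 : ((k : ℤ) + 1 - i) = (j : ℤ) := by omega
    rw [e1, e2, e3, prediction]
    have := h.spot j
    linear_combination (-2 * θ.rho3 * θ.γ i) * this
  rw [hpast, θ.sum_alphaG_mul hp (fun i => I ((k + 1 : ℕ) + 1 - i : ℤ)), prediction, drift, omegaG]
  have e4 : ∑ i ∈ Finset.Icc 2 θ.p, θ.α i * I ((k + 1 : ℕ) + 1 - ((i - 1 : ℕ) : ℤ))
      = ∑ i ∈ Finset.Icc 2 θ.p, θ.α i * I ((k + 1 : ℕ) - i + 2 : ℤ) := by
    refine Finset.sum_congr rfl fun i hi => ?_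
    have := (Finset.mem_Icc.1 hi).1
    congr 2
    omega
  have e5 : ∑ i ∈ Finset.Icc 1 θ.p, θ.α i * I ((k + 1 : ℕ) + 1 - i : ℤ)
      = ∑ i ∈ Finset.Icc 1 θ.p, θ.α i * I (k + 2 - i : ℤ) := by
    refine Finset.sum_congr rfl fun i _ => ?_
    congr 2
  have e6 : ((k + 1 : ℕ) : ℤ) = (k : ℤ) + 1 := by push_cast; ring
  rw [e4, e5]
  simp only [e6] at hspot ⊢
  rw [hspot, ω]
  ring

/-- The recursion for the integrated betas. -/
theorem int_eq (h : θ.IsSolution b I d) (hp : 1 ≤ θ.p) {n : ℕ} (hn : max θ.q 1 ≤ n) :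
    I (n + 1 : ℤ) = θ.omegaG
      + ∑ i ∈ Finset.Icc 1 (max θ.p θ.q),
          ((if i ≤ θ.q then θ.γ i else 0) + θ.alphaG i) * I (n + 1 - i : ℤ)
      + (d n - ∑ i ∈ Finset.Icc 1 θ.q, θ.γ i * d (n - i)) := by
  -- Replacing each past prediction by `I - d` turns the recursion into an autoregression of `I`
  -- with moving average input; its coefficients are those of the stability hypothesis.
  have hpast : ∑ i ∈ Finset.Icc 1 θ.q, θ.γ i * θ.prediction b I (n - i : ℤ)
      = ∑ i ∈ Finset.Icc 1 θ.q, θ.γ i * I (n + 1 - i : ℤ)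
        - ∑ i ∈ Finset.Icc 1 θ.q, θ.γ i * d (n - i) := by
    rw [← Finset.sum_sub_distrib]
    refine Finset.sum_congr rfl fun i hi => ?_
    have hi2 : i ≤ n := (Finset.mem_Icc.1 hi).2.trans ((le_max_left _ _).trans hn)
    have e1 : ((n : ℤ) - i) = ((n - i : ℕ) : ℤ) := by omega
    have e2 : ((n : ℤ) + 1 - i) = ((n - i : ℕ) : ℤ) + 1 := by omega
    rw [e1, e2, h.int (n - i)]
    ring
  rw [h.int n, h.prediction_eq hp hn, hpast]
  simp only [add_mul, Finset.sum_add_distrib, ite_mul, zero_mul]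
  rw [sum_Icc_ite_le _ (le_max_right _ _)]
  ring

end IsSolution

end DRBetaParam

/-! ### Contractive autoregressions -/

/-- A sequence dominated by a contractive autoregression with bounded input is bounded. -/
theorem exists_bound_of_le_sum {x : ℕ → ℝ} {M N₀ : ℕ} {a : ℕ → ℝ} {c : ℝ}
    (ha : ∀ i, 0 ≤ a i) (hsum : ∑ i ∈ Finset.Icc 1 M, a i < 1)
    (h : ∀ n, N₀ ≤ n → x (n + 1) ≤ c + ∑ i ∈ Finset.Icc 1 M, a i * x (n + 1 - i)) :
    ∃ B, ∀ n, x n ≤ B := by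
  set ρ := ∑ i ∈ Finset.Icc 1 M, a i with hρ
  have h1ρ : 0 < 1 - ρ := by linarith
  -- The first term makes `c + ρ B ≤ B`; the sum covers the values up to `N₀`, not controlled by the
  -- recursion.
  set B := |c| / (1 - ρ) + ∑ k ∈ Finset.range (N₀ + 1), |x k| with hB
  have hcB : c + ρ * B ≤ B := by
    have h1 : |c| / (1 - ρ) ≤ B := le_add_of_nonneg_right (Finset.sum_nonneg fun _ _ => abs_nonneg _)
    rw [div_le_iff₀ h1ρ] at h1
    linarith [le_abs_self c]
  refine ⟨B, fun n => ?_⟩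
  induction n using Nat.strong_induction_on with
  | _ n ih =>
    rcases Nat.lt_or_ge n (N₀ + 1) with hn | hn
    · calc x n ≤ |x n| := le_abs_self _
        _ ≤ ∑ k ∈ Finset.range (N₀ + 1), |x k| :=
          Finset.single_le_sum (f := fun k => |x k|) (fun _ _ => abs_nonneg _)
            (Finset.mem_range.2 hn)
        _ ≤ B := le_add_of_nonneg_left (div_nonneg (abs_nonneg _) h1ρ.le)
    · obtain ⟨k, rfl⟩ : ∃ k, n = k + 1 := ⟨n - 1, by omega⟩
      refine (h k (by omega)).trans (le_trans ?_ hcB)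
      rw [hρ, Finset.sum_mul]
      gcongr with i hi
      · exact ha i
      · exact ih _ (by have := (Finset.mem_Icc.1 hi).1; omega)

/-- A nonnegative sequence dominated by a contractive autoregression with vanishing input
vanishes in the limit. -/
theorem tendsto_zero_of_le_sum {x e : ℕ → ℝ} {M N₀ : ℕ} {a : ℕ → ℝ} (hx : ∀ n, 0 ≤ x n)
    (ha : ∀ i, 0 ≤ a i) (hsum : ∑ i ∈ Finset.Icc 1 M, a i < 1) (he : Tendsto e atTop (𝓝 0))
    (h : ∀ n, N₀ ≤ n → x (n + 1) ≤ e n + ∑ i ∈ Finset.Icc 1 M, a i * x (n + 1 - i)) :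
    Tendsto x atTop (𝓝 0) := by
  obtain ⟨c, hc⟩ := he.bddAbove_range
  obtain ⟨B, hB⟩ := exists_bound_of_le_sum ha hsum fun n hn =>
    (h n hn).trans (by gcongr; exact hc (Set.mem_range_self n))
  have hbdd : IsBoundedUnder (· ≤ ·) atTop x := isBoundedUnder_of ⟨B, hB⟩
  have hcob : IsCoboundedUnder (· ≤ ·) atTop x :=
    (isBoundedUnder_of ⟨0, hx⟩ : IsBoundedUnder (· ≥ ·) atTop x).isCoboundedUnder_le
  set ρ := ∑ i ∈ Finset.Icc 1 M, a i with hρ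
  set L := limsup x atTop with hL
  have hρ0 : 0 ≤ ρ := Finset.sum_nonneg fun i _ => ha i
  have key : ∀ ε > 0, L ≤ ε + ρ * (L + ε) := by
    intro ε hε
    have h1 : ∀ᶠ n in atTop, x n < L + ε := eventually_lt_of_limsup_lt (by linarith) hbdd
    have h2 : ∀ᶠ n in atTop, e n < ε := he.eventually_lt_const hε
    obtain ⟨N₁, hN₁⟩ := eventually_atTop.1 h1
    obtain ⟨N₂, hN₂⟩ := eventually_atTop.1 h2
    refine limsup_le_of_le hcob (eventually_atTop.2 ⟨N₀ + N₁ + N₂ + M + 1, fun n hn => ?_⟩)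
    obtain ⟨k, rfl⟩ : ∃ k, n = k + 1 := ⟨n - 1, by omega⟩
    refine (h k (by omega)).trans ?_
    rw [hρ, Finset.sum_mul]
    gcongr with i hi
    · exact (hN₂ k (by omega)).le
    · exact ha i
    · exact (hN₁ _ (by have := (Finset.mem_Icc.1 hi).2; omega)).le
  have hL0 : L ≤ 0 := by
    by_contra hpos
    rw [not_le] at hpos
    -- With this `ε`, `key` gives `(1 - ρ) L ≤ (1 + ρ) ε < 2 ε = (1 - ρ) L / 2`, impossible for `L >
    -- 0`.
    have := key ((1 - ρ) * L / 4) (by have : 0 < 1 - ρ := by linarith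
                                      positivity)
    nlinarith [mul_pos hpos (sub_pos.2 hsum), mul_nonneg hρ0 hpos.le]
  refine Metric.tendsto_atTop.2 fun ε hε => ?_
  have h1 : ∀ᶠ n in atTop, x n < ε := eventually_lt_of_limsup_lt (hL0.trans_lt hε) hbdd
  obtain ⟨N, hN⟩ := eventually_atTop.1 h1
  refine ⟨N, fun n hn => ?_⟩
  rw [Real.dist_0_eq_abs, abs_of_nonneg (hx n)]
  exact hN n hn

/-! ### Homogeneous dynamics and the solution started from zero -/

namespace DRBetaParam

variable (θ : DRBetaParam)

/-- The parameter of the homogeneous dynamics. -/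
def homogeneous : DRBetaParam := { θ with ω₁ := 0, ω₂ := 0 }

theorem drift_congr {b b' I I' : ℤ → ℝ} {n : ℤ} (hb : ∀ k ≤ n, b k = b' k)
    (hI : ∀ k ≤ n, I k = I' k) : θ.drift b I n = θ.drift b' I' n := by
  unfold drift
  congr 1
  · congr 1
    refine Finset.sum_congr rfl fun i hi => ?_
    rw [hb _ (by have := (Finset.mem_Icc.1 hi).1; omega)]
  · refine Finset.sum_congr rfl fun i hi => ?_
    rw [hI _ (by have := (Finset.mem_Icc.1 hi).1; omega)]

theorem prediction_congr {b b' I I' : ℤ → ℝ} {n : ℤ} (hb : ∀ k ≤ n, b k = b' k)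
    (hI : ∀ k ≤ n, I k = I' k) : θ.prediction b I n = θ.prediction b' I' n := by
  rw [prediction, prediction, θ.drift_congr hb hI, hb n le_rfl]

theorem drift_sub (b b' I I' : ℤ → ℝ) (n : ℤ) :
    θ.homogeneous.drift (b - b') (I - I') n = θ.drift b I n - θ.drift b' I' n := by
  simp only [drift, homogeneous, Pi.sub_apply, mul_sub, Finset.sum_sub_distrib]
  ring

namespace IsSolution

variable {θ} {b b' I I' : ℤ → ℝ} {d : ℕ → ℝ}

/-- The system is affine, so constants and common innovations cancel in the difference. -/
theorem sub (h : θ.IsSolution b I d) (h' : θ.IsSolution b' I' d) :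
    θ.homogeneous.IsSolution (b - b') (I - I') 0 where
  spot n := by
    rw [drift_sub, Pi.sub_apply, Pi.sub_apply, h.spot, h'.spot]
    simp only [homogeneous]
    ring
  int n := by
    rw [prediction, drift_sub, Pi.sub_apply, Pi.sub_apply, h.int, h'.int, prediction, prediction]
    simp only [homogeneous, rho1, rho2, rho3, Pi.zero_apply]
    ring

/-- Solutions of the homogeneous dynamics vanish in the limit. -/
theorem tendsto_zero (h : θ.homogeneous.IsSolution b I 0) (hp : 1 ≤ θ.p)
    (hγ : ∑ i ∈ Finset.Icc 1 θ.q, |θ.γ i| < 1)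
    (hstab : ∑ i ∈ Finset.Icc 1 (max θ.p θ.q),
      |(if i ≤ θ.q then θ.γ i else 0) + θ.alphaG i| < 1) :
    Tendsto (fun n : ℕ => b n) atTop (𝓝 0) ∧ Tendsto (fun n : ℕ => I n) atTop (𝓝 0) := by
  -- The integrated betas form a closed autoregression, so they decay first; they then enter the
  -- spot recursion as a vanishing input. The threshold `p + q + 1` keeps every lagged index
  -- natural.
  have hI : Tendsto (fun n : ℕ => I n) atTop (𝓝 0) := by
    refine (tendsto_zero_iff_abs_tendsto_zero _).2 (tendsto_zero_of_le_sum (N₀ := θ.p + θ.q + 1)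
      (fun n => abs_nonneg _) (fun i => abs_nonneg _) hstab
      (tendsto_const_nhds (x := (0 : ℝ))) fun n hn => ?_)
    have hn' : max θ.homogeneous.q 1 ≤ n := by
      change max θ.q 1 ≤ n
      omega
    have heq := h.int_eq hp hn'
    have hω : θ.homogeneous.omegaG = 0 := by simp [omegaG, ω, homogeneous]
    simp only [hω, Pi.zero_apply, mul_zero, Finset.sum_const_zero, sub_zero, add_zero,
      zero_add] at heq
    rw [zero_add]
    simp only [Function.comp_apply, Nat.cast_add, Nat.cast_one]
    rw [heq]
    refine (Finset.abs_sum_le_sum_abs _ _).trans_eq (Finset.sum_congr rfl fun i hi => ?_)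
    have hi' : i ≤ max θ.p θ.q := (Finset.mem_Icc.1 hi).2
    rw [abs_mul, show ((n + 1 - i : ℕ) : ℤ) = (n : ℤ) + 1 - i by omega]
    rfl
  refine ⟨?_, hI⟩
  have he : Tendsto (fun n : ℕ => ∑ i ∈ Finset.Icc 1 θ.p, |θ.α i| * |I (n + 2 - i : ℤ)|) atTop
      (𝓝 0) := by
    rw [← Finset.sum_const_zero (s := Finset.Icc 1 θ.p)]
    refine tendsto_finsetSum _ fun i _ => ?_
    rw [← mul_zero |θ.α i|]
    refine Tendsto.const_mul _ ?_
    have h2 : Tendsto (fun n : ℕ => n + 2 - i) atTop atTop :=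
      tendsto_atTop_mono (fun n => by omega) (tendsto_sub_atTop_nat i)
    refine (((tendsto_zero_iff_abs_tendsto_zero _).1 hI).comp h2).congr' ?_
    filter_upwards [eventually_ge_atTop i] with n hn
    simp only [Function.comp_apply]
    rw [show ((n + 2 - i : ℕ) : ℤ) = (n : ℤ) + 2 - i by omega]
  refine (tendsto_zero_iff_abs_tendsto_zero _).2 (tendsto_zero_of_le_sum (N₀ := θ.p + θ.q + 1)
      (fun n => abs_nonneg _) (fun i => abs_nonneg _) hγ he fun n hn => ?_)
  have heq := h.spot_eq hp n
  have hω : θ.homogeneous.ω = 0 := by simp [ω, homogeneous]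
  rw [hω, zero_add] at heq
  simp only [Function.comp_apply, Nat.cast_add, Nat.cast_one]
  rw [heq, add_comm]
  refine (abs_add_le _ _).trans (add_le_add ?_ ?_)
  · refine (Finset.abs_sum_le_sum_abs _ _).trans_eq (Finset.sum_congr rfl fun i hi => ?_)
    rw [abs_mul]
    rfl
  · refine (Finset.abs_sum_le_sum_abs _ _).trans_eq (Finset.sum_congr rfl fun i hi => ?_)
    have hi' : i ≤ θ.q := (Finset.mem_Icc.1 hi).2
    rw [abs_mul, show ((n + 1 - i : ℕ) : ℤ) = (n : ℤ) + 1 - i by omega]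
    rfl

end IsSolution

/-- The solution with zero initial values, computed up to time `n`. -/
noncomputable def solveUpTo (d : ℕ → ℝ) : ℕ → (ℤ → ℝ) × (ℤ → ℝ)
  | 0 => (0, 0)
  | n + 1 =>
    let s := solveUpTo d n
    let i := θ.prediction s.1 s.2 n + d n
    (Function.update s.1 (n + 1) (θ.drift s.1 s.2 n - θ.ω₂ + θ.α 1 * i),
      Function.update s.2 (n + 1) i)

/-- The spot betas of the solution with zero initial values. -/
noncomputable def zeroSpot (d : ℕ → ℝ) (k : ℤ) : ℝ := (θ.solveUpTo d k.toNat).1 k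

/-- The integrated betas of the solution with zero initial values. -/
noncomputable def zeroInt (d : ℕ → ℝ) (k : ℤ) : ℝ := (θ.solveUpTo d k.toNat).2 k

/-- Each step changes only the entry at the new time, so earlier entries are final. -/
theorem solveUpTo_eq (d : ℕ → ℝ) {n : ℕ} {k : ℤ} (hk : k ≤ n) :
    (θ.solveUpTo d n).1 k = θ.zeroSpot d k ∧ (θ.solveUpTo d n).2 k = θ.zeroInt d k := by
  induction n with
  | zero =>
    have : k.toNat = 0 := by omega
    simp [zeroSpot, zeroInt, this]
  | succ n ih =>
    rcases eq_or_ne k (n + 1) with rfl | hne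
    · have : ((n : ℤ) + 1).toNat = n + 1 := by omega
      simp [zeroSpot, zeroInt, this]
    · simp only [solveUpTo, Function.update_of_ne hne]
      exact ih (by push_cast at hk; omega)

theorem isSolution_zero (d : ℕ → ℝ) : θ.IsSolution (θ.zeroSpot d) (θ.zeroInt d) d := by
  have hint : ∀ n : ℕ, θ.zeroInt d (n + 1 : ℤ)
      = θ.prediction (θ.zeroSpot d) (θ.zeroInt d) n + d n := fun n => by
    rw [← (θ.solveUpTo_eq d (n := n + 1) (by push_cast; rfl)).2, solveUpTo]
    simp only [Function.update_self]
    rw [θ.prediction_congr (fun k hk => (θ.solveUpTo_eq d hk).1)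
      (fun k hk => (θ.solveUpTo_eq d hk).2)]
  refine ⟨fun n => ?_, hint⟩
  rw [hint, ← (θ.solveUpTo_eq d (n := n + 1) (by push_cast; rfl)).1, solveUpTo]
  simp only [Function.update_self]
  rw [θ.prediction_congr (fun k hk => (θ.solveUpTo_eq d hk).1)
      (fun k hk => (θ.solveUpTo_eq d hk).2), θ.drift_congr (fun k hk => (θ.solveUpTo_eq d hk).1)
      (fun k hk => (θ.solveUpTo_eq d hk).2)]

theorem zeroSpot_of_nonpos (d : ℕ → ℝ) {k : ℤ} (hk : k ≤ 0) : θ.zeroSpot d k = 0 := by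
  simp [zeroSpot, Int.toNat_of_nonpos hk, solveUpTo]

theorem zeroInt_of_nonpos (d : ℕ → ℝ) {k : ℤ} (hk : k ≤ 0) : θ.zeroInt d k = 0 := by
  simp [zeroInt, Int.toNat_of_nonpos hk, solveUpTo]

end DRBetaParam

/-! ### Tools in `L^r` -/

section Lp

variable {Ω : Type*} [mΩ : MeasurableSpace Ω] {P : Measure Ω}

theorem memLp_sum_mul {ι : Type*} {s : Finset ι} {a : ι → ℝ} {f : ι → Ω → ℝ} {r : ℝ≥0∞}
    (hf : ∀ i ∈ s, MemLp (f i) r P) : MemLp (fun ω => ∑ i ∈ s, a i * f i ω) r P :=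
  memLp_finsetSum s fun i hi => (hf i hi).const_mul (a i)

theorem lpNorm_add_sum_le {ι : Type*} {s : Finset ι} {a : ι → ℝ} {g : Ω → ℝ} {f : ι → Ω → ℝ}
    {r : ℝ≥0∞} (hr : 1 ≤ r) (hg : MemLp g r P) (hf : ∀ i ∈ s, MemLp (f i) r P) :
    lpNorm (fun ω => g ω + ∑ i ∈ s, a i * f i ω) r P
      ≤ lpNorm g r P + ∑ i ∈ s, |a i| * lpNorm (f i) r P := by
  have h1 := lpNorm_add_le (g := ∑ i ∈ s, a i • f i) hg hr
  have h2 := lpNorm_sum_le (f := fun i => a i • f i)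
    (fun i hi => (hf i hi).const_smul (a i)) hr
  simp only [lpNorm_const_smul] at h2
  refine le_trans (le_of_eq ?_) (h1.trans (add_le_add le_rfl h2))
  congr 1
  ext ω
  simp

/-- Bounded functions that converge to zero almost everywhere converge to zero in `L^r`. -/
theorem tendsto_eLpNorm_zero_of_bounded [IsFiniteMeasure P] {f : ℕ → Ω → ℝ} {K r : ℝ≥0}
    (hr : r ≠ 0) (hf : ∀ n, AEStronglyMeasurable (f n) P) (hK : ∀ n ω, ‖f n ω‖ ≤ K)
    (h : ∀ᵐ ω ∂P, Tendsto (fun n => f n ω) atTop (𝓝 0)) :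
    Tendsto (fun n => eLpNorm (f n) r P) atTop (𝓝 0) := by
  have hr' : (0 : ℝ) < r := by positivity
  have h1 : Tendsto (fun n => ∫⁻ ω, ‖f n ω‖ₑ ^ (r : ℝ) ∂P) atTop (𝓝 (∫⁻ _, 0 ∂P)) := by
    refine tendsto_lintegral_of_dominated_convergence' (fun _ => (K : ℝ≥0∞) ^ (r : ℝ))
      (fun n => ((hf n).enorm.pow_const _)) (fun n => ae_of_all _ fun ω => ?_) ?_ ?_
    · exact ENNReal.rpow_le_rpow (enorm_le_coe.2 (hK n ω)) r.2
    · rw [lintegral_const]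
      exact ENNReal.mul_ne_top (ENNReal.rpow_ne_top_of_nonneg r.2 ENNReal.coe_ne_top)
        (measure_ne_top _ _)
    · filter_upwards [h] with ω hω
      have h2 := (ENNReal.continuous_rpow_const (y := (r : ℝ))).tendsto 0 |>.comp
        (by simpa using hω.enorm : Tendsto (fun n => ‖f n ω‖ₑ) atTop (𝓝 0))
      rwa [ENNReal.zero_rpow_of_pos hr'] at h2
  have h3 := ((ENNReal.continuous_rpow_const (y := 1 / (r : ℝ))).tendsto _).comp h1
  rw [lintegral_zero, ENNReal.zero_rpow_of_pos (by positivity)] at h3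
  refine h3.congr fun n => ?_
  rw [eLpNorm_eq_lintegral_rpow_enorm_toReal (by exact_mod_cast hr) ENNReal.coe_ne_top]
  rfl

/-- If copies of `X` split into a part that vanishes almost surely in the limit and a part that is
bounded in `L^r`, then `X` is in `L^r`. -/
theorem memLp_of_identDistrib_add [IsProbabilityMeasure P] {X : Ω → ℝ} {U V : ℕ → Ω → ℝ} {r : ℝ≥0}
    (hr : 1 ≤ r) (hU : ∀ n, AEStronglyMeasurable (U n) P) (hV : ∀ n, AEStronglyMeasurable (V n) P)
    (hX : ∀ n, IdentDistrib (fun ω => U n ω + V n ω) X P P)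
    (hlim : ∀ᵐ ω ∂P, Tendsto (fun n => U n ω) atTop (𝓝 0)) {B : ℝ≥0∞} (hB : B ≠ ∞)
    (hbd : ∀ n, eLpNorm (V n) r P ≤ B) : MemLp X r P := by
  have hr1 : (1 : ℝ≥0∞) ≤ r := by exact_mod_cast hr
  have hXm : AEStronglyMeasurable X P := (hX 0).aemeasurable_snd.aestronglyMeasurable
  have htm : ∀ K : ℝ≥0, Measurable fun x : ℝ => min |x| (K : ℝ) := fun K =>
    (continuous_abs.min continuous_const).measurable
  -- By equality of laws the truncated norm of `X` is that of `U n + V n` for every `n`. Since `min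
  -- |U + V| K ≤ min |U| K + |V|` and the first term vanishes in `L^r` by dominated convergence, the
  -- bound `B` does not depend on `K`.
  have htrunc : ∀ K : ℝ≥0, eLpNorm (fun ω => min |X ω| (K : ℝ)) r P ≤ B := by
    intro K
    have hle : ∀ n, eLpNorm (fun ω => min |X ω| (K : ℝ)) r P
        ≤ eLpNorm (fun ω => min |U n ω| (K : ℝ)) r P + B := by
      intro n
      have h1 := ((hX n).comp (htm K)).eLpNorm_eq r
      have hUm : AEStronglyMeasurable (fun ω => min |U n ω| (K : ℝ)) P :=
        ((htm K).comp_aemeasurable (hU n).aemeasurable).aestronglyMeasurable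
      have hVm : AEStronglyMeasurable (fun ω => |V n ω|) P := (hV n).norm
      calc eLpNorm (fun ω => min |X ω| (K : ℝ)) r P
          = eLpNorm (fun ω => min |U n ω + V n ω| (K : ℝ)) r P := h1.symm
        _ ≤ eLpNorm ((fun ω => min |U n ω| (K : ℝ)) + fun ω => |V n ω|) r P := by
            refine eLpNorm_mono_real fun ω => ?_
            have h0 : 0 ≤ min |U n ω + V n ω| (K : ℝ) := le_min (abs_nonneg _) K.2
            rw [Real.norm_of_nonneg h0, Pi.add_apply]
            rcases le_total |U n ω| (K : ℝ) with h | h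
            · rw [min_eq_left h]
              exact (min_le_left _ _).trans (abs_add_le _ _)
            · rw [min_eq_right h]
              exact (min_le_right _ _).trans (le_add_of_nonneg_right (abs_nonneg _))
        _ ≤ _ := (eLpNorm_add_le hUm hVm hr1).trans
            (add_le_add le_rfl ((eLpNorm_norm (V n)).trans_le (hbd n)))
    have hlim0 : Tendsto (fun n => eLpNorm (fun ω => min |U n ω| (K : ℝ)) r P) atTop (𝓝 0) := by
      refine tendsto_eLpNorm_zero_of_bounded (K := K) (by rintro rfl; simp at hr)
        (fun n => ((htm K).comp_aemeasurable (hU n).aemeasurable).aestronglyMeasurable)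
        (fun n ω => ?_) ?_
      · have h0 : 0 ≤ min |U n ω| (K : ℝ) := le_min (abs_nonneg _) K.2
        rw [Real.norm_of_nonneg h0]
        exact min_le_right _ _
      · filter_upwards [hlim] with ω hω
        have := (hω.abs).min (tendsto_const_nhds (x := (K : ℝ)))
        simpa using this
    have hlim1 := hlim0.add_const B
    rw [zero_add] at hlim1
    exact ge_of_tendsto' hlim1 hle
  refine ⟨hXm, lt_of_le_of_lt ?_ hB.lt_top⟩
  rw [← eLpNorm_norm]
  refine Lp.eLpNorm_le_of_ae_tendsto (u := atTop) (f := fun (k : ℕ) ω => min |X ω| ((k : ℝ≥0) : ℝ))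
    (Eventually.of_forall fun k => htrunc k)
    (fun k => ((htm k).comp_aemeasurable hXm.aemeasurable).aestronglyMeasurable)
    (ae_of_all _ fun ω => ?_)
  obtain ⟨N, hN⟩ := exists_nat_ge |X ω|
  refine tendsto_atTop_of_eventually_const (i₀ := N) fun k hk => ?_
  rw [Real.norm_eq_abs, min_eq_left]
  exact hN.trans (by exact_mod_cast hk)

end Lp

/-! ### Moments along solutions -/

namespace DRBetaParam

variable (θ : DRBetaParam) {Ω : Type*} [mΩ : MeasurableSpace Ω] {P : Measure Ω}
  [IsProbabilityMeasure P] {r : ℝ≥0∞}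

theorem memLp_drift {b I : ℤ → Ω → ℝ} {n : ℤ}
    (hb : ∀ k, n + 1 - θ.q ≤ k → k ≤ n → MemLp (b k) r P)
    (hI : ∀ k, n + 2 - θ.p ≤ k → k ≤ n → MemLp (I k) r P) :
    MemLp (fun ω => θ.drift (fun k => b k ω) (fun k => I k ω) n) r P := by
  have h0 : MemLp (fun _ : Ω => θ.ω₁) r P := memLp_const _
  have h1 : MemLp (fun ω => ∑ i ∈ Finset.Icc 1 θ.q, θ.γ i * b (n + 1 - i) ω) r P :=
    memLp_sum_mul (f := fun i : ℕ => b (n + 1 - i)) fun i hi => by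
      obtain ⟨h1, h2⟩ := Finset.mem_Icc.1 hi
      exact hb _ (by omega) (by omega)
  have h2 : MemLp (fun ω => ∑ i ∈ Finset.Icc 2 θ.p, θ.α i * I (n - i + 2) ω) r P :=
    memLp_sum_mul (f := fun i : ℕ => I (n - i + 2)) fun i hi => by
      obtain ⟨h1, h2⟩ := Finset.mem_Icc.1 hi
      exact hI _ (by omega) (by omega)
  exact (h0.add h1).add h2

theorem memLp_prediction {b I : ℤ → Ω → ℝ} {n : ℤ}
    (hb : ∀ k, n + 1 - max θ.q 1 ≤ k → k ≤ n → MemLp (b k) r P)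
    (hI : ∀ k, n + 2 - θ.p ≤ k → k ≤ n → MemLp (I k) r P) :
    MemLp (fun ω => θ.prediction (fun k => b k ω) (fun k => I k ω) n) r P := by
  have hdrift := θ.memLp_drift (P := P) (r := r) (n := n) (fun k h1 h2 => hb k (by omega) h2) hI
  have hbn := hb n (by omega) le_rfl
  unfold prediction
  exact ((hbn.const_mul _).add (hdrift.const_mul _)).sub (memLp_const _)

/-- Moments propagate along solutions of the dynamics. -/
theorem memLp_of_isSolution {b I : ℤ → Ω → ℝ} {d : ℕ → Ω → ℝ}
    (h : ∀ᵐ ω ∂P, θ.IsSolution (fun k => b k ω) (fun k => I k ω) (fun n => d n ω))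
    (hb : ∀ k : ℤ, 1 - max θ.q 1 ≤ k → k ≤ 0 → MemLp (b k) r P)
    (hI : ∀ k : ℤ, 2 - θ.p ≤ k → k ≤ 0 → MemLp (I k) r P) (hd : ∀ n, MemLp (d n) r P) (n : ℕ) :
    (∀ k : ℤ, 1 - max θ.q 1 ≤ k → k ≤ n → MemLp (b k) r P) ∧
      (∀ k : ℤ, 2 - θ.p ≤ k → k ≤ n → MemLp (I k) r P) := by
  induction n with
  | zero => exact ⟨hb, hI⟩
  | succ n ih =>
    obtain ⟨ihb, ihI⟩ := ih
    have hnewI : MemLp (I (n + 1 : ℤ)) r P := by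
      refine MemLp.ae_eq ?_ ((θ.memLp_prediction (n := n) (fun k h1 h2 => ihb k (by omega) h2)
        (fun k h1 h2 => ihI k (by omega) h2)).add (hd n))
      filter_upwards [h] with ω hω
      exact (hω.int n).symm
    have hnewb : MemLp (b (n + 1 : ℤ)) r P := by
      refine MemLp.ae_eq ?_ (((θ.memLp_drift (n := n) (fun k h1 h2 => ihb k (by omega) h2)
        (fun k h1 h2 => ihI k (by omega) h2)).sub (memLp_const θ.ω₂)).add
          (hnewI.const_mul (θ.α 1)))
      filter_upwards [h] with ω hω
      exact (hω.spot n).symm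
    constructor <;> intro k h1 h2 <;> rcases eq_or_ne k (n + 1) with rfl | hne
    · exact hnewb
    · exact ihb k h1 (by push_cast at h2; omega)
    · exact hnewI
    · exact ihI k h1 (by push_cast at h2; omega)

theorem memLp_zero_solution (hp : 1 ≤ θ.p) {d : ℕ → Ω → ℝ} (hd : ∀ n, MemLp (d n) r P) (k : ℤ) :
    MemLp (fun ω => θ.zeroSpot (fun n => d n ω) k) r P ∧
      MemLp (fun ω => θ.zeroInt (fun n => d n ω) k) r P := by
  have hb0 : ∀ k ≤ 0, MemLp (fun ω => θ.zeroSpot (fun n => d n ω) k) r P := fun k hk => by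
    simp_rw [θ.zeroSpot_of_nonpos _ hk]
    exact MemLp.zero
  have hI0 : ∀ k ≤ 0, MemLp (fun ω => θ.zeroInt (fun n => d n ω) k) r P := fun k hk => by
    simp_rw [θ.zeroInt_of_nonpos _ hk]
    exact MemLp.zero
  rcases le_or_gt k 0 with hk | hk
  · exact ⟨hb0 k hk, hI0 k hk⟩
  · obtain ⟨n, rfl⟩ := Int.eq_ofNat_of_zero_le hk.le
    obtain ⟨h1, h2⟩ := θ.memLp_of_isSolution (P := P) (r := r)
        (b := fun k ω => θ.zeroSpot (fun n => d n ω) k)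
        (I := fun k ω => θ.zeroInt (fun n => d n ω) k)
        (ae_of_all _ fun ω => θ.isSolution_zero fun n => d n ω)
        (fun k _ => hb0 k) (fun k _ => hI0 k) hd n
    exact ⟨h1 _ (by omega) le_rfl, h2 _ (by omega) le_rfl⟩

/-- With innovations bounded in `L^r`, the integrated betas of the solution with zero initial values
are bounded in `L^r`. -/
theorem exists_lpNorm_zeroInt_le (hr : 1 ≤ r) (hp : 1 ≤ θ.p)
    (hstab : ∑ i ∈ Finset.Icc 1 (max θ.p θ.q),
      |(if i ≤ θ.q then θ.γ i else 0) + θ.alphaG i| < 1)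
    {d : ℕ → Ω → ℝ} (hd : ∀ n, MemLp (d n) r P) {c : ℝ} (hc : ∀ n, lpNorm (d n) r P ≤ c) :
    ∃ B, ∀ n : ℕ, lpNorm (fun ω => θ.zeroInt (fun n => d n ω) n) r P ≤ B := by
  have hmem : ∀ n : ℕ, MemLp (fun ω => θ.zeroInt (fun n => d n ω) n) r P :=
    fun n => (θ.memLp_zero_solution hp hd n).2
  -- The triangle inequality in `L^r` turns `int_eq` into a contractive inequality for norms; the
  -- constant collects the intercept, the new innovation and the `q` lagged ones.
  refine exists_bound_of_le_sum (N₀ := θ.p + θ.q + 1)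
    (c := lpNorm (fun _ : Ω => θ.omegaG) r P + c + ∑ i ∈ Finset.Icc 1 θ.q, |-θ.γ i| * c)
    (fun i => abs_nonneg _) hstab fun n hn => ?_
  have heq : (fun ω => θ.zeroInt (fun n => d n ω) (n + 1 : ℕ)) = fun ω =>
      (((fun _ : Ω => θ.omegaG) + d n) ω + ∑ i ∈ Finset.Icc 1 θ.q, (-θ.γ i) * d (n - i) ω)
        + ∑ i ∈ Finset.Icc 1 (max θ.p θ.q), ((if i ≤ θ.q then θ.γ i else 0) + θ.alphaG i)
          * θ.zeroInt (fun n => d n ω) (n + 1 - i : ℕ) := by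
    ext ω
    have h1 := (θ.isSolution_zero fun n => d n ω).int_eq hp (n := n) (by omega)
    rw [Nat.cast_add, Nat.cast_one, h1, Finset.sum_congr rfl fun i hi => by
      rw [show ((n : ℤ) + 1 - i) = ((n + 1 - i : ℕ) : ℤ) by
        have := (Finset.mem_Icc.1 hi).2; omega]]
    simp only [Pi.add_apply, neg_mul, Finset.sum_neg_distrib]
    ring
  have hmc : MemLp (fun _ : Ω => θ.omegaG) r P := memLp_const _
  have hmg : MemLp ((fun _ : Ω => θ.omegaG) + d n) r P := hmc.add (hd n)
  have hms : MemLp (fun ω => ∑ i ∈ Finset.Icc 1 θ.q, (-θ.γ i) * d (n - i) ω) r P :=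
    memLp_sum_mul (f := fun i => d (n - i)) fun i _ => hd (n - i)
  have h1 := lpNorm_add_sum_le (s := Finset.Icc 1 (max θ.p θ.q))
    (a := fun i => (if i ≤ θ.q then θ.γ i else 0) + θ.alphaG i)
    (f := fun i ω => θ.zeroInt (fun n => d n ω) (n + 1 - i : ℕ)) hr (hmg.add hms)
    (fun i _ => hmem _)
  have h2 := lpNorm_add_sum_le (s := Finset.Icc 1 θ.q) (a := fun i => -θ.γ i)
    (f := fun i => d (n - i)) hr hmg fun i _ => hd (n - i)
  have h3 := lpNorm_add_le (g := d n) hmc hr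
  have h4 : ∑ i ∈ Finset.Icc 1 θ.q, |-θ.γ i| * lpNorm (d (n - i)) r P
      ≤ ∑ i ∈ Finset.Icc 1 θ.q, |-θ.γ i| * c :=
    Finset.sum_le_sum fun i _ => mul_le_mul_of_nonneg_left (hc _) (abs_nonneg _)
  rw [heq]
  exact h1.trans (add_le_add (h2.trans (add_le_add (h3.trans (add_le_add le_rfl (hc n))) h4))
    le_rfl)

/-- With innovations bounded in `L^r`, the spot betas of the solution with zero initial values
are bounded in `L^r`. -/
theorem exists_lpNorm_zeroSpot_le (hr : 1 ≤ r) (hp : 1 ≤ θ.p)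
    (hγ : ∑ i ∈ Finset.Icc 1 θ.q, |θ.γ i| < 1)
    {d : ℕ → Ω → ℝ} (hd : ∀ n, MemLp (d n) r P) {B : ℝ}
    (hB : ∀ n : ℕ, lpNorm (fun ω => θ.zeroInt (fun n => d n ω) n) r P ≤ B) :
    ∃ B', ∀ n : ℕ, lpNorm (fun ω => θ.zeroSpot (fun n => d n ω) n) r P ≤ B' := by
  have hmem := fun n : ℕ => θ.memLp_zero_solution hp hd n
  refine exists_bound_of_le_sum (N₀ := θ.p + θ.q + 1)
    (c := lpNorm (fun _ : Ω => θ.ω) r P + ∑ i ∈ Finset.Icc 1 θ.p, |θ.α i| * B)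
    (fun i => abs_nonneg _) hγ fun n hn => ?_
  have heq : (fun ω => θ.zeroSpot (fun n => d n ω) (n + 1 : ℕ)) = fun ω =>
      ((fun _ : Ω => θ.ω) ω + ∑ i ∈ Finset.Icc 1 θ.p, θ.α i *
          θ.zeroInt (fun n => d n ω) (n + 2 - i : ℕ))
        + ∑ i ∈ Finset.Icc 1 θ.q, θ.γ i * θ.zeroSpot (fun n => d n ω) (n + 1 - i : ℕ) := by
    ext ω
    have h1 := (θ.isSolution_zero fun n => d n ω).spot_eq hp n
    rw [Nat.cast_add, Nat.cast_one, h1, add_right_comm]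
    congr 1
    · congr 1
      refine Finset.sum_congr rfl fun i hi => ?_
      rw [show ((n : ℤ) + 2 - i) = ((n + 2 - i : ℕ) : ℤ) by
        have := (Finset.mem_Icc.1 hi).2; omega]
    · refine Finset.sum_congr rfl fun i hi => ?_
      rw [show ((n : ℤ) + 1 - i) = ((n + 1 - i : ℕ) : ℤ) by
        have := (Finset.mem_Icc.1 hi).2; omega]
  have hmc : MemLp (fun _ : Ω => θ.ω) r P := memLp_const _
  have hms : MemLp (fun ω => ∑ i ∈ Finset.Icc 1 θ.p, θ.α i *
      θ.zeroInt (fun n => d n ω) (n + 2 - i : ℕ)) r P :=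
    memLp_sum_mul (f := fun i ω => θ.zeroInt (fun n => d n ω) (n + 2 - i : ℕ))
      fun i _ => (hmem _).2
  have h1 := lpNorm_add_sum_le (s := Finset.Icc 1 θ.q) (a := θ.γ)
    (f := fun i ω => θ.zeroSpot (fun n => d n ω) (n + 1 - i : ℕ)) hr (hmc.add hms)
    (fun i _ => (hmem _).1)
  have h2 := lpNorm_add_sum_le (s := Finset.Icc 1 θ.p) (a := θ.α)
    (f := fun i ω => θ.zeroInt (fun n => d n ω) (n + 2 - i : ℕ)) hr hmc (fun i _ => (hmem _).2)
  have h3 : ∑ i ∈ Finset.Icc 1 θ.p,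
        |θ.α i| * lpNorm (fun ω => θ.zeroInt (fun n => d n ω) (n + 2 - i : ℕ)) r P
      ≤ ∑ i ∈ Finset.Icc 1 θ.p, |θ.α i| * B :=
    Finset.sum_le_sum fun i _ => mul_le_mul_of_nonneg_left (hB _) (abs_nonneg _)
  rw [heq]
  exact h1.trans (add_le_add (h2.trans (add_le_add le_rfl h3)) le_rfl)

end DRBetaParam

/-! ### From the diffusion to the discrete time dynamics -/

theorem spotBeta_natCast {Ω : Type*} (β : ℝ≥0 → Ω → ℝ) (b₀ : ℤ → Ω → ℝ) (n : ℕ) :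
    spotBeta β b₀ n = β n := by
  ext ω
  simp [spotBeta]

theorem intBeta_natCast_succ {Ω : Type*} (β : ℝ≥0 → Ω → ℝ) (J₀ : ℤ → Ω → ℝ) (n : ℕ) (ω : Ω) :
    intBeta β J₀ (n + 1 : ℤ) ω = ∫ s in (n : ℝ)..(n + 1 : ℕ), β s.toNNReal ω := by
  rw [intBeta, if_pos (by omega)]
  push_cast
  rw [add_sub_cancel_right]

theorem spotBeta_of_neg {Ω : Type*} (β : ℝ≥0 → Ω → ℝ) (b₀ : ℤ → Ω → ℝ) {k : ℤ} (hk : k < 0) :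
    spotBeta β b₀ k = b₀ k := by
  ext ω
  rw [spotBeta, if_neg (by omega)]

theorem intBeta_of_nonpos {Ω : Type*} (β : ℝ≥0 → Ω → ℝ) (J₀ : ℤ → Ω → ℝ) {k : ℤ} (hk : k ≤ 0) :
    intBeta β J₀ k = J₀ k := by
  ext ω
  rw [intBeta, if_neg (by omega)]

namespace DRBetaParam

theorem measurable_prediction (θ : DRBetaParam) {Ω : Type*} {m : MeasurableSpace Ω}
    {b I : ℤ → Ω → ℝ} {n : ℤ}
    (hb : ∀ k : ℤ, n + 1 - max θ.q 1 ≤ k → k ≤ n → Measurable (b k))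
    (hI : ∀ k : ℤ, n + 2 - θ.p ≤ k → k ≤ n → Measurable (I k)) :
    Measurable fun ω => θ.prediction (fun k => b k ω) (fun k => I k ω) n := by
  unfold prediction drift
  refine (((hb n (by omega) le_rfl).const_mul _).add ((((Finset.measurable_fun_sum _
    fun i hi => ?_).const_add _).add (Finset.measurable_fun_sum _
      fun i hi => ?_)).const_mul _)).sub_const _ <;> obtain ⟨h1, h2⟩ := Finset.mem_Icc.1 hi
  · exact (hb _ (by omega) (by omega)).const_mul _
  · exact (hI _ (by omega) (by omega)).const_mul _

end DRBetaParam

namespace IsDRBetaDiffusion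

variable {Ω : Type*} [mΩ : MeasurableSpace Ω] {θ : DRBetaParam} {P : Measure Ω}
  {F : Filtration ℝ≥0 mΩ} {Z β : ℝ≥0 → Ω → ℝ} {b₀ J₀ : ℤ → Ω → ℝ}

/-- The values at integer times solve the discrete time dynamics. -/
theorem isSolution (h : IsDRBetaDiffusion θ P F Z β b₀ J₀) (hα : θ.α 1 ≠ 0)
    (hZ : IsFilteredBrownian P F Z) :
    ∀ᵐ ω ∂P, θ.IsSolution (fun k => spotBeta β b₀ k ω) (fun k => intBeta β J₀ k ω)
      (fun n => θ.ν * θ.noise Z n ω) := by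
  filter_upwards [h.continuous, hZ.brownian.cont, h.eq] with ω hβc hZc heq
  have hf : Continuous fun s : ℝ => β s.toNNReal ω := hβc.comp continuous_real_toNNReal
  have hz : Continuous fun s : ℝ => Z s.toNNReal ω := hZc.comp continuous_real_toNNReal
  have hpath : ∀ n : ℕ, ∀ t ∈ Set.Ico (n : ℝ) (n + 1 : ℕ), β t.toNNReal ω = β n ω
      + (t - n) ^ 2 * θ.drift (fun k => spotBeta β b₀ k ω) (fun k => intBeta β J₀ k ω) n
      - (t - n) * (θ.ω₂ + β n ω) + θ.α 1 * (∫ s in (n : ℝ)..t, β s.toNNReal ω)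
      + θ.ν * (n + 1 - t) * (Z t.toNNReal ω - Z (n : ℝ).toNNReal ω) := by
    intro n t ht
    have ht0 : 0 ≤ t := n.cast_nonneg.trans ht.1
    have hfl : n = ⌊t.toNNReal⌋₊ := by
      symm
      rw [Nat.floor_eq_iff zero_le]
      constructor
      · exact NNReal.natCast_le_toNNReal ht.1
      · have h2 := ht.2
        rw [← NNReal.coe_lt_coe]
        push_cast at h2 ⊢
        rwa [Real.coe_toNNReal _ ht0]
    have h1 := heq t.toNNReal n hfl
    rw [Real.coe_toNNReal _ ht0] at h1
    rw [h1, Real.toNNReal_natCast]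
    rfl
  constructor
  · intro n
    have h1 := θ.path_end (z := fun s => Z s.toNNReal ω) hf hz (hpath n)
    rw [intBeta_natCast_succ, show ((n : ℤ) + 1) = ((n + 1 : ℕ) : ℤ) by push_cast; rfl,
      spotBeta_natCast, ← h1, Real.toNNReal_natCast]
  · intro n
    have h1 := θ.integral_path (z := fun s => Z s.toNNReal ω) hα hf hz (hpath n)
    rw [intBeta_natCast_succ, h1, DRBetaParam.prediction, spotBeta_natCast, DRBetaParam.noise,
      Real.toNNReal_natCast]

theorem measurable_spotBeta (h : IsDRBetaDiffusion θ P F Z β b₀ J₀) {k : ℤ} {n : ℕ}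
    (h1 : 1 - max θ.q 1 ≤ k) (h2 : k ≤ n) :
    Measurable[F (n : ℝ≥0)] (spotBeta β b₀ k) := by
  rcases lt_or_ge k 0 with hk | hk
  · rw [spotBeta_of_neg _ _ hk]
    exact ((h.measurable_b₀ k (by omega) hk).mono (F.mono zero_le)).measurable
  · obtain ⟨m, rfl⟩ := Int.eq_ofNat_of_zero_le hk
    rw [spotBeta_natCast]
    exact ((h.adapted m).mono (F.mono (by exact_mod_cast h2))).measurable

/-- The integrated betas have adapted versions. -/
theorem exists_version_intBeta (h : IsDRBetaDiffusion θ P F Z β b₀ J₀) :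
    ∃ J : ℤ → Ω → ℝ, (∀ (k : ℤ) (n : ℕ), 2 - θ.p ≤ k → k ≤ n → Measurable[F (n : ℝ≥0)] (J k)) ∧
      ∀ k, J k =ᵐ[P] intBeta β J₀ k := by
  have key : ∀ k : ℤ, ∃ J : Ω → ℝ,
      (∀ n : ℕ, 2 - θ.p ≤ k → k ≤ n → Measurable[F (n : ℝ≥0)] J) ∧ J =ᵐ[P] intBeta β J₀ k := by
    intro k
    rcases le_or_gt k 0 with hk | hk
    · refine ⟨J₀ k, fun n h1 _ => ((h.measurable_J₀ k h1 hk).mono (F.mono zero_le)).measurable, ?_⟩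
      rw [intBeta_of_nonpos _ _ hk]
    · obtain ⟨n, rfl⟩ : ∃ n : ℕ, k = n + 1 := ⟨(k - 1).toNat, by omega⟩
      obtain ⟨J, hJm, hJ⟩ := exists_stronglyMeasurable_integral (m := F ((n + 1 : ℕ) : ℝ≥0))
        (μ := P) (Y := fun u => β u.toNNReal) (a := n) (b := (n + 1 : ℕ)) (by push_cast; linarith)
        (by filter_upwards [h.continuous] with ω hω using hω.comp continuous_real_toNNReal)
        (fun u hu => ((h.adapted _).mono (F.mono (by
          simpa using Real.toNNReal_le_toNNReal hu))).measurable)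
      refine ⟨J, fun m _ hm => (hJm.mono (F.mono (by exact_mod_cast hm))).measurable, ?_⟩
      filter_upwards [hJ] with ω hω
      rw [hω, intBeta_natCast_succ]
  choose J h1 h2 using key
  exact ⟨J, h1, h2⟩

theorem aestronglyMeasurable_spotBeta (h : IsDRBetaDiffusion θ P F Z β b₀ J₀) (n : ℕ) :
    AEStronglyMeasurable (spotBeta β b₀ n) P :=
  ((h.measurable_spotBeta (n := n) (by omega) le_rfl).mono (F.le _) le_rfl).aestronglyMeasurable

theorem aestronglyMeasurable_intBeta (h : IsDRBetaDiffusion θ P F Z β b₀ J₀) (hp : 1 ≤ θ.p)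
    {n : ℕ} (hn : 1 ≤ n) : AEStronglyMeasurable (intBeta β J₀ n) P := by
  obtain ⟨J, hJm, hJ⟩ := h.exists_version_intBeta
  exact AEStronglyMeasurable.congr ((hJm n n (by omega) le_rfl).mono
    (F.le _) le_rfl).aestronglyMeasurable (hJ n)

/-- The point is uniformity in `n`, the input for the bounds on the zero solution. -/
theorem exists_lpNorm_noise_le (hZ : IsFilteredBrownian P F Z) {r : ℝ≥0} (hr : 1 ≤ r) :
    ∃ c, ∀ n, lpNorm (fun ω => θ.ν * θ.noise Z n ω) r P ≤ c := by
  refine ⟨|θ.ν| * (ENNReal.ofReal (Real.exp |θ.α 1|)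
    * eLpNorm id r (gaussianReal 0 1)).toReal, fun n => ?_⟩
  have h1 := lpNorm_const_smul (p := r) θ.ν (θ.noise Z n) P
  refine (le_of_eq h1).trans ?_
  rw [coe_nnnorm, Real.norm_eq_abs]
  gcongr
  rw [← toReal_eLpNorm (θ.aestronglyMeasurable_noise hZ.brownian n)]
  exact ENNReal.toReal_mono (ENNReal.mul_ne_top ENNReal.ofReal_ne_top
    (memLp_id_gaussianReal r).2.ne) (θ.eLpNorm_noise_le hZ.brownian hr n)

variable [IsProbabilityMeasure P]

/-- Moments of the initial values propagate. -/
theorem memLp_of_initial (h : IsDRBetaDiffusion θ P F Z β b₀ J₀) (hα : θ.α 1 ≠ 0)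
    (hZ : IsFilteredBrownian P F Z) (hinit : InitialMoments θ P β b₀ J₀) (r : ℝ≥0) :
    (∀ k : ℤ, 1 - max θ.q 1 ≤ k → MemLp (spotBeta β b₀ k) r P) ∧
      (∀ k : ℤ, 2 - θ.p ≤ k → MemLp (intBeta β J₀ k) r P) := by
  obtain ⟨h0, hb, hJ⟩ := hinit r
  have key := θ.memLp_of_isSolution (h.isSolution hα hZ) (r := r) (fun k h1 h2 => ?_)
    (fun k h1 h2 => ?_) (fun n => (θ.memLp_noise hZ.brownian r n).const_mul θ.ν)
  · exact ⟨fun k hk => (key k.toNat).1 k hk (by omega), fun k hk => (key k.toNat).2 k hk (by omega)⟩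
  · rcases eq_or_lt_of_le h2 with rfl | h2
    · rw [show spotBeta β b₀ 0 = β 0 by simpa using spotBeta_natCast β b₀ 0]
      exact h0
    · rw [spotBeta_of_neg _ _ h2]
      exact hb k (by omega) h2
  · rw [intBeta_of_nonpos _ _ h2]
    exact hJ k h1 h2

end IsDRBetaDiffusion

/-! ### Moments of a stationary process -/

namespace IsStationaryDR

variable {Ω : Type*} [mΩ : MeasurableSpace Ω] {θ : DRBetaParam} {P : Measure Ω}
  {F : Filtration ℝ≥0 mΩ} {Z β : ℝ≥0 → Ω → ℝ} {b₀ J₀ : ℤ → Ω → ℝ}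

theorem identDistrib_spotBeta (hs : IsStationaryDR θ P β b₀ J₀) (n : ℕ) {i : ℕ}
    (hi : i < max θ.q 1) :
    IdentDistrib (spotBeta β b₀ (n - i : ℤ)) (spotBeta β b₀ (-i : ℤ)) P P := by
  have h1 := (hs n).comp (u := fun x => x.1 ⟨i, hi⟩) (by fun_prop)
  simpa [Function.comp_def, drState] using h1

theorem identDistrib_intBeta (hs : IsStationaryDR θ P β b₀ J₀) (n : ℕ) {i : ℕ}
    (hi : i < θ.p - 1) :
    IdentDistrib (intBeta β J₀ (n - i : ℤ)) (intBeta β J₀ (-i : ℤ)) P P := by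
  have h1 := (hs n).comp (u := fun x => x.2 ⟨i, hi⟩) (by fun_prop)
  simpa [Function.comp_def, drState] using h1

/-- The initial values of a stationary process have moments of every order. -/
theorem initialMoments [IsProbabilityMeasure P] (hs : IsStationaryDR θ P β b₀ J₀)
    (h : IsDRBetaDiffusion θ P F Z β b₀ J₀) (hp : 1 ≤ θ.p) (hα : θ.α 1 ≠ 0)
    (hγ : ∑ i ∈ Finset.Icc 1 θ.q, |θ.γ i| < 1)
    (hstab : ∑ i ∈ Finset.Icc 1 (max θ.p θ.q),
      |(if i ≤ θ.q then θ.γ i else 0) + θ.alphaG i| < 1)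
    (hZ : IsFilteredBrownian P F Z) : InitialMoments θ P β b₀ J₀ := by
  set d : ℕ → Ω → ℝ := fun n ω => θ.ν * θ.noise Z n ω with hd
  have hlim : ∀ᵐ ω ∂P,
      Tendsto (fun n : ℕ => spotBeta β b₀ n ω - θ.zeroSpot (fun n => d n ω) n) atTop (𝓝 0) ∧
      Tendsto (fun n : ℕ => intBeta β J₀ n ω - θ.zeroInt (fun n => d n ω) n) atTop (𝓝 0) := by
    filter_upwards [h.isSolution hα hZ] with ω hω
    exact (hω.sub (θ.isSolution_zero _)).tendsto_zero hp hγ hstab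
  have key : ∀ r : ℝ≥0, 1 ≤ r →
      (∀ i < max θ.q 1, MemLp (spotBeta β b₀ (-i : ℤ)) r P) ∧
        (∀ i < θ.p - 1, MemLp (intBeta β J₀ (-i : ℤ)) r P) := by
    intro r hr
    have hr1 : (1 : ℝ≥0∞) ≤ r := by exact_mod_cast hr
    have hdm : ∀ n, MemLp (d n) r P := fun n => (θ.memLp_noise hZ.brownian r n).const_mul θ.ν
    obtain ⟨c, hc⟩ := IsDRBetaDiffusion.exists_lpNorm_noise_le (θ := θ) hZ hr
    obtain ⟨B, hB⟩ := θ.exists_lpNorm_zeroInt_le hr1 hp hstab hdm hc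
    obtain ⟨B', hB'⟩ := θ.exists_lpNorm_zeroSpot_le hr1 hp hγ hdm hB
    have hmem := fun n : ℕ => θ.memLp_zero_solution hp hdm n
    constructor
    · intro i hi
      refine memLp_of_identDistrib_add hr
        (U := fun n ω => spotBeta β b₀ n ω - θ.zeroSpot (fun n => d n ω) n)
        (V := fun n ω => θ.zeroSpot (fun n => d n ω) n)
        (fun n => (h.aestronglyMeasurable_spotBeta n).sub (hmem n).1.aestronglyMeasurable)
        (fun n => (hmem n).1.aestronglyMeasurable) (fun n => ?_)
        (hlim.mono fun ω hω => hω.1) (B := ENNReal.ofReal B') ENNReal.ofReal_ne_top fun n => ?_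
      -- Component `i` of the state at time `n + i` is `β_n`, which therefore has the law of the
      -- initial value `β_{-i}`.
      · have h1 := hs.identDistrib_spotBeta (n + i) hi
        simpa using h1
      · rw [← ofReal_lpNorm (hmem n).1]
        exact ENNReal.ofReal_le_ofReal (hB' n)
    · intro i hi
      refine memLp_of_identDistrib_add hr
        -- Times start at `1`, where the integrated beta is a path integral and
        -- `aestronglyMeasurable_intBeta` applies.
        (U := fun n ω => intBeta β J₀ (n + 1 : ℕ) ω - θ.zeroInt (fun n => d n ω) (n + 1 : ℕ))
        (V := fun n ω => θ.zeroInt (fun n => d n ω) (n + 1 : ℕ))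
        (fun n => (h.aestronglyMeasurable_intBeta hp (Nat.le_add_left 1 n)).sub
          (hmem (n + 1)).2.aestronglyMeasurable)
        (fun n => (hmem (n + 1)).2.aestronglyMeasurable) (fun n => ?_)
        (hlim.mono fun ω hω => hω.2.comp (tendsto_add_atTop_nat 1)) (B := ENNReal.ofReal B)
        ENNReal.ofReal_ne_top fun n => ?_
      · have h1 := hs.identDistrib_intBeta (n + 1 + i) hi
        rw [show (((n + 1 + i : ℕ) : ℤ) - i) = (n + 1 : ℕ) by push_cast; ring] at h1
        simpa using h1
      · rw [← ofReal_lpNorm (hmem (n + 1)).2]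
        exact ENNReal.ofReal_le_ofReal (hB (n + 1))
  intro r
  obtain ⟨h1, h2⟩ := key (max r 1) (le_max_right _ _)
  have hle : (r : ℝ≥0∞) ≤ (max r 1 : ℝ≥0) := by exact_mod_cast le_max_left r 1
  refine ⟨?_, fun k hk1 hk2 => ?_, fun k hk1 hk2 => ?_⟩
  · have h3 := (h1 0 (by omega)).mono_exponent hle
    rwa [show (-(0 : ℕ) : ℤ) = ((0 : ℕ) : ℤ) by simp, spotBeta_natCast, Nat.cast_zero] at h3
  · have h3 := (h1 (-k).toNat (by omega)).mono_exponent hle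
    rwa [show (-((-k).toNat : ℤ)) = k by omega, spotBeta_of_neg _ _ hk2] at h3
  · have h3 := (h2 (-k).toNat (by omega)).mono_exponent hle
    rwa [show (-((-k).toNat : ℤ)) = k by omega, intBeta_of_nonpos _ _ hk2] at h3

end IsStationaryDR

/-! ### Means under stationarity -/

/-- `X` is integrable with mean `m`. -/
def HasMean {Ω : Type*} [MeasurableSpace Ω] (P : Measure Ω) (X : Ω → ℝ) (m : ℝ) : Prop :=
  Integrable X P ∧ ∫ ω, X ω ∂P = m

namespace HasMean

variable {Ω : Type*} [mΩ : MeasurableSpace Ω] {P : Measure Ω} {X Y : Ω → ℝ} {x y : ℝ}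

theorem congr (h : HasMean P X x) (hXY : X =ᵐ[P] Y) : HasMean P Y x :=
  ⟨h.1.congr hXY, by rw [← integral_congr_ae hXY, h.2]⟩

theorem unique (h : HasMean P X x) (h' : HasMean P X y) : x = y := h.2.symm.trans h'.2

theorem add (hX : HasMean P X x) (hY : HasMean P Y y) :
    HasMean P (fun ω => X ω + Y ω) (x + y) :=
  ⟨hX.1.add hY.1, by rw [integral_add hX.1 hY.1, hX.2, hY.2]⟩

theorem const_mul (hX : HasMean P X x) (c : ℝ) : HasMean P (fun ω => c * X ω) (c * x) :=
  ⟨hX.1.const_mul c, by rw [integral_const_mul, hX.2]⟩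

theorem const [IsProbabilityMeasure P] (c : ℝ) : HasMean P (fun _ => c) c :=
  ⟨integrable_const c, by simp⟩

theorem sub_const [IsProbabilityMeasure P] (hX : HasMean P X x) (c : ℝ) :
    HasMean P (fun ω => X ω - c) (x - c) := by
  simpa [sub_eq_add_neg] using hX.add (const (-c))

theorem sum_mul {s : Finset ℕ} {a : ℕ → ℝ} {f : ℕ → Ω → ℝ} (h : ∀ i ∈ s, HasMean P (f i) x) :
    HasMean P (fun ω => ∑ i ∈ s, a i * f i ω) ((∑ i ∈ s, a i) * x) := by
  refine ⟨integrable_finsetSum s fun i hi => (h i hi).1.const_mul (a i), ?_⟩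
  rw [integral_finsetSum s fun i hi => (h i hi).1.const_mul (a i), Finset.sum_mul]
  exact Finset.sum_congr rfl fun i hi => ((h i hi).const_mul (a i)).2

end HasMean

theorem MeasureTheory.MemLp.hasMean {Ω : Type*} [MeasurableSpace Ω] {P : Measure Ω}
    [IsProbabilityMeasure P] {X : Ω → ℝ} (h : MemLp X ((1 : ℝ≥0) : ℝ≥0∞) P) :
    HasMean P X (∫ ω, X ω ∂P) :=
  ⟨h.integrable (by simp), rfl⟩

namespace DRBetaParam

variable (θ : DRBetaParam) {Ω : Type*} [mΩ : MeasurableSpace Ω] {P : Measure Ω}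
  [IsProbabilityMeasure P]

theorem hasMean_prediction {b I : ℤ → Ω → ℝ} {n : ℤ} {x y : ℝ}
    (hb : ∀ k : ℤ, n + 1 - max θ.q 1 ≤ k → k ≤ n → HasMean P (b k) x)
    (hI : ∀ k : ℤ, n + 2 - θ.p ≤ k → k ≤ n → HasMean P (I k) y) :
    HasMean P (fun ω => θ.prediction (fun k => b k ω) (fun k => I k ω) n)
      ((θ.rho1 - θ.rho2) * x + 2 * θ.rho3 * (θ.ω₁ + (∑ i ∈ Finset.Icc 1 θ.q, θ.γ i) * x
        + (∑ i ∈ Finset.Icc 2 θ.p, θ.α i) * y) - θ.rho2 * θ.ω₂) := by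
  have h1 : HasMean P (fun ω => ∑ i ∈ Finset.Icc 1 θ.q, θ.γ i * b (n + 1 - i) ω)
      ((∑ i ∈ Finset.Icc 1 θ.q, θ.γ i) * x) :=
    HasMean.sum_mul (f := fun i : ℕ => b (n + 1 - i)) fun i hi => by
      obtain ⟨h1, h2⟩ := Finset.mem_Icc.1 hi
      exact hb _ (by omega) (by omega)
  have h2 : HasMean P (fun ω => ∑ i ∈ Finset.Icc 2 θ.p, θ.α i * I (n - i + 2) ω)
      ((∑ i ∈ Finset.Icc 2 θ.p, θ.α i) * y) :=
    HasMean.sum_mul (f := fun i : ℕ => I (n - i + 2)) fun i hi => by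
      obtain ⟨h1, h2⟩ := Finset.mem_Icc.1 hi
      exact hI _ (by omega) (by omega)
  exact (((hb n (by omega) le_rfl).const_mul _).add
    ((((HasMean.const θ.ω₁).add h1).add h2).const_mul _)).sub_const _

/-- The means of the predictions and of the spot betas when they do not depend on time. -/
theorem hasMean_of_isSolution {b I : ℤ → Ω → ℝ} {d : ℕ → Ω → ℝ}
    (h : ∀ᵐ ω ∂P, θ.IsSolution (fun k => b k ω) (fun k => I k ω) (fun n => d n ω))
    (hd : ∀ n, HasMean P (d n) 0) (hp : 1 ≤ θ.p)
    (hγ : ∑ i ∈ Finset.Icc 1 θ.q, |θ.γ i| < 1)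
    (hstab : ∑ i ∈ Finset.Icc 1 (max θ.p θ.q),
      |(if i ≤ θ.q then θ.γ i else 0) + θ.alphaG i| < 1)
    {x y : ℝ} (hb : ∀ k : ℤ, 1 - max θ.q 1 ≤ k → HasMean P (b k) x)
    (hI : ∀ k : ℤ, 2 - θ.p ≤ k → 2 ≤ θ.p → HasMean P (I k) y) (n : ℕ) :
    HasMean P (fun ω => θ.prediction (fun k => b k ω) (fun k => I k ω) n) (θ.omegaG /
      (1 - ∑ i ∈ Finset.Icc 1 θ.q, θ.γ i - ∑ j ∈ Finset.Icc 1 (max θ.p θ.q), θ.alphaG j)) ∧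
    HasMean P (b n) ((θ.ω * (1 - ∑ i ∈ Finset.Icc 1 θ.q, θ.γ i
        - ∑ j ∈ Finset.Icc 1 (max θ.p θ.q), θ.alphaG j)
      + θ.omegaG * ∑ i ∈ Finset.Icc 1 θ.p, θ.α i) /
      ((1 - ∑ i ∈ Finset.Icc 1 θ.q, θ.γ i - ∑ j ∈ Finset.Icc 1 (max θ.p θ.q), θ.alphaG j)
        * (1 - ∑ i ∈ Finset.Icc 1 θ.q, θ.γ i))) := by
  set Γ := ∑ i ∈ Finset.Icc 1 θ.q, θ.γ i with hΓ
  set S := ∑ j ∈ Finset.Icc 1 (max θ.p θ.q), θ.alphaG j with hS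
  set T := ∑ i ∈ Finset.Icc 1 θ.p, θ.α i with hT
  have hΓ1 : 0 < 1 - Γ := by
    have : Γ ≤ ∑ i ∈ Finset.Icc 1 θ.q, |θ.γ i| := Finset.sum_le_sum fun i _ => le_abs_self _
    linarith
  -- Dropping absolute values in the stability hypothesis gives `Γ + S < 1`, so the denominators are
  -- positive.
  have hS1 : 0 < 1 - Γ - S := by
    have h1 := Finset.sum_le_sum fun i (_ : i ∈ Finset.Icc 1 (max θ.p θ.q)) =>
      le_abs_self ((if i ≤ θ.q then θ.γ i else 0) + θ.alphaG i)
    rw [Finset.sum_add_distrib, sum_Icc_ite_le _ (le_max_right _ _), ← hΓ, ← hS] at h1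
    linarith
  set m := (θ.rho1 - θ.rho2) * x + 2 * θ.rho3 * (θ.ω₁ + Γ * x
        + (∑ i ∈ Finset.Icc 2 θ.p, θ.α i) * y) - θ.rho2 * θ.ω₂ with hm
  have hpred : ∀ n : ℕ,
      HasMean P (fun ω => θ.prediction (fun k => b k ω) (fun k => I k ω) n) m := fun n =>
    θ.hasMean_prediction (fun k h1 _ => hb k (by omega))
      (fun k h1 h2 => hI k (by omega) (by omega))
  -- This comes from `I = prediction + d`, not from the state, which contains no integrated beta
  -- when `p = 1`.
  have hint : ∀ k : ℤ, 1 ≤ k → HasMean P (I k) m := by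
    intro k hk
    obtain ⟨n, rfl⟩ : ∃ n : ℕ, k = n + 1 := ⟨(k - 1).toNat, by omega⟩
    have h1 := (hpred n).add (hd n)
    rw [add_zero] at h1
    refine h1.congr ?_
    filter_upwards [h] with ω hω using (hω.int n).symm
  -- Expectations are taken in the recursion at a time late enough that every lagged integrated beta
  -- has index at least `1`.
  have hmeq : m = θ.omegaG + Γ * m + S * m := by
    refine (hpred (θ.p + θ.q + 1)).unique ((((HasMean.const θ.omegaG).add
      (HasMean.sum_mul (s := Finset.Icc 1 θ.q) (a := θ.γ)
        (f := fun i ω => θ.prediction (fun k => b k ω) (fun k => I k ω)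
          ((θ.p + θ.q + 1 : ℕ) - i : ℤ)) fun i hi => ?_)).add
      (HasMean.sum_mul (s := Finset.Icc 1 (max θ.p θ.q)) (a := θ.alphaG)
        (f := fun i => I ((θ.p + θ.q + 1 : ℕ) + 1 - i : ℤ)) fun i hi => ?_)).congr ?_)
    · have h1 := hpred (θ.p + θ.q + 1 - i)
      rwa [show ((θ.p + θ.q + 1 - i : ℕ) : ℤ) = (θ.p + θ.q + 1 : ℕ) - i by
        have := (Finset.mem_Icc.1 hi).2; omega] at h1
    · exact hint _ (by have := (Finset.mem_Icc.1 hi).2; omega)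
    · filter_upwards [h] with ω hω
      exact (hω.prediction_eq hp (n := θ.p + θ.q + 1) (by omega)).symm
  have hxeq : x = θ.ω + Γ * x + T * m := by
    refine (hb (θ.p + 1 + 1 : ℤ) (by omega)).unique ((((HasMean.const θ.ω).add
      (HasMean.sum_mul (s := Finset.Icc 1 θ.q) (a := θ.γ)
        (f := fun i => b ((θ.p + 1 : ℕ) + 1 - i : ℤ)) fun i hi => ?_)).add
      (HasMean.sum_mul (s := Finset.Icc 1 θ.p) (a := θ.α)
        (f := fun i => I ((θ.p + 1 : ℕ) + 2 - i : ℤ)) fun i hi => ?_)).congr ?_)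
    · exact hb _ (by have := (Finset.mem_Icc.1 hi).2; omega)
    · exact hint _ (by have := (Finset.mem_Icc.1 hi).2; omega)
    · filter_upwards [h] with ω hω
      exact (hω.spot_eq hp (θ.p + 1)).symm
  have hmval : m = θ.omegaG / (1 - Γ - S) := by
    rw [eq_div_iff hS1.ne']
    linarith
  have hxval : x = (θ.ω * (1 - Γ - S) + θ.omegaG * T) / ((1 - Γ - S) * (1 - Γ)) := by
    have hx1 : x * (1 - Γ) = θ.ω + T * m := by linarith
    rw [eq_div_iff (mul_pos hS1 hΓ1).ne']
    have hm1 : m * (1 - Γ - S) = θ.omegaG := by linarith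
    linear_combination (1 - Γ - S) * hx1 + T * hm1
  rw [← hmval, ← hxval]
  exact ⟨hpred n, hb n (by omega)⟩

end DRBetaParam

section Means

variable {Ω : Type*} [mΩ : MeasurableSpace Ω] {θ : DRBetaParam} {P : Measure Ω}
  {F : Filtration ℝ≥0 mΩ} {Z β : ℝ≥0 → Ω → ℝ} {b₀ J₀ : ℤ → Ω → ℝ}

/-- The components of the state are integrable, with means that do not depend on time. -/
structure HasConstantMeans (θ : DRBetaParam) (P : Measure Ω) (β : ℝ≥0 → Ω → ℝ)
    (b₀ J₀ : ℤ → Ω → ℝ) : Prop where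
  spot : ∀ n i : ℕ, i < max θ.q 1 →
    HasMean P (spotBeta β b₀ (n - i : ℤ)) (∫ ω, spotBeta β b₀ (-i : ℤ) ω ∂P)
  int : ∀ n i : ℕ, i < θ.p - 1 →
    HasMean P (intBeta β J₀ (n - i : ℤ)) (∫ ω, intBeta β J₀ (-i : ℤ) ω ∂P)

theorem HasConstantMeans.hasMean_spot (h : HasConstantMeans θ P β b₀ J₀) {k : ℤ}
    (hk : 1 - max θ.q 1 ≤ k) :
    HasMean P (spotBeta β b₀ k) (∫ ω, spotBeta β b₀ 0 ω ∂P) := by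
  rcases le_or_gt 0 k with h0 | h0
  · obtain ⟨n, rfl⟩ := Int.eq_ofNat_of_zero_le h0
    simpa using h.spot n 0 (by omega)
  · obtain ⟨i, rfl⟩ : ∃ i : ℕ, k = -i := ⟨(-k).toNat, by omega⟩
    have h1 := h.spot 0 i (by omega)
    -- At time `i`, component `i` of the state is `β_0`; this links the mean of `β_{-i}` to that of
    -- `β_0`.
    have h2 := h.spot i i (by omega)
    rw [sub_self] at h2
    rw [h2.2]
    simpa using h1

theorem HasConstantMeans.hasMean_int (h : HasConstantMeans θ P β b₀ J₀) (hp : 2 ≤ θ.p) {k : ℤ}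
    (hk : 2 - θ.p ≤ k) :
    HasMean P (intBeta β J₀ k) (∫ ω, intBeta β J₀ 0 ω ∂P) := by
  rcases le_or_gt 0 k with h0 | h0
  · obtain ⟨n, rfl⟩ := Int.eq_ofNat_of_zero_le h0
    simpa using h.int n 0 (by omega)
  · obtain ⟨i, rfl⟩ : ∃ i : ℕ, k = -i := ⟨(-k).toNat, by omega⟩
    have h1 := h.int 0 i (by omega)
    have h2 := h.int i i (by omega)
    rw [sub_self] at h2
    rw [h2.2]
    simpa using h1

theorem IsMeanStationaryDR.hasConstantMeans (h : IsMeanStationaryDR θ P β b₀ J₀) :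
    HasConstantMeans θ P β b₀ J₀ := by
  -- Coordinates are continuous linear functionals, which commute with the vector-valued integral.
  have key : ∀ (L : ((Fin (max θ.q 1) → ℝ) × (Fin (θ.p - 1) → ℝ)) →L[ℝ] ℝ) (n : ℕ),
      HasMean P (fun ω => L (drState θ β b₀ J₀ n ω)) (∫ ω, L (drState θ β b₀ J₀ 0 ω) ∂P) := by
    intro L n
    refine ⟨L.integrable_comp (h n).1, ?_⟩
    rw [L.integral_comp_comm (h n).1, L.integral_comp_comm (h 0).1, (h n).2]
  constructor
  · intro n i hi
    have h1 := key ((ContinuousLinearMap.proj (R := ℝ) (φ := fun _ => ℝ) ⟨i, hi⟩).comp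
      (ContinuousLinearMap.fst ℝ _ _)) n
    simpa [drState] using h1
  · intro n i hi
    have h1 := key ((ContinuousLinearMap.proj (R := ℝ) (φ := fun _ => ℝ) ⟨i, hi⟩).comp
      (ContinuousLinearMap.snd ℝ _ _)) n
    simpa [drState] using h1

theorem IsStationaryDR.hasConstantMeans [IsProbabilityMeasure P]
    (hs : IsStationaryDR θ P β b₀ J₀) (h : IsDRBetaDiffusion θ P F Z β b₀ J₀)
    (hα : θ.α 1 ≠ 0) (hZ : IsFilteredBrownian P F Z) (hinit : InitialMoments θ P β b₀ J₀) :
    HasConstantMeans θ P β b₀ J₀ := by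
  obtain ⟨h1, h2⟩ := h.memLp_of_initial hα hZ hinit 1
  constructor
  · intro n i hi
    exact ⟨(h1 _ (by omega)).hasMean.1, (hs.identDistrib_spotBeta n hi).integral_eq⟩
  · intro n i hi
    exact ⟨(h2 _ (by omega)).hasMean.1, (hs.identDistrib_intBeta n hi).integral_eq⟩

end Means

theorem DRBetaParam.hasMean_noise (θ : DRBetaParam) {Ω : Type*} [mΩ : MeasurableSpace Ω]
    {P : Measure Ω} [IsProbabilityMeasure P] {F : Filtration ℝ≥0 mΩ} {Z : ℝ≥0 → Ω → ℝ}
    (hα : θ.α 1 ≠ 0) (hZ : IsFilteredBrownian P F Z) (n : ℕ) :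
    HasMean P (fun ω => θ.ν * θ.noise Z n ω) 0 := by
  have h1 : HasMean P (θ.noise Z n) 0 := by
    refine ⟨(θ.memLp_noise hZ.brownian 1 n).hasMean.1, ?_⟩
    have := θ.setIntegral_noise hα hZ n (A := Set.univ) MeasurableSet.univ
    rwa [Measure.restrict_univ] at this
  simpa using h1.const_mul θ.ν

/-! ### Assembly -/

theorem proposition1 (θ : DRBetaParam) (hp : 1 ≤ θ.p) (hα : θ.α 1 ≠ 0)
    (hγ : ∑ i ∈ Finset.Icc 1 θ.q, |θ.γ i| < 1)
    (hstab : ∑ i ∈ Finset.Icc 1 (max θ.p θ.q),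
      |(if i ≤ θ.q then θ.γ i else 0) + θ.alphaG i| < 1) :
    ∃ C : ℝ, 0 < C ∧
    ∀ (Ω : Type*) [mΩ : MeasurableSpace Ω] (P : Measure Ω) [IsProbabilityMeasure P]
      (F : Filtration ℝ≥0 mΩ) (Z : ℝ≥0 → Ω → ℝ) (β : ℝ≥0 → Ω → ℝ) (b₀ J₀ : ℤ → Ω → ℝ),
      IsFilteredBrownian P F Z → IsDRBetaDiffusion θ P F Z β b₀ J₀ →
    ∃ h D : ℕ → Ω → ℝ,
      -- (a) decomposition, recursion for `h`, explicit martingale difference `D`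
      (∀ n : ℕ, 1 ≤ n →
        StronglyMeasurable[F ((n - 1 : ℕ) : ℝ≥0)] (h n) ∧
        (∃ W : Ω → ℝ,
          IsWienerIntegral P Z ((n - 1 : ℕ) : ℝ≥0) (n : ℝ≥0) (θ.kernel n) W ∧
          D n =ᵐ[P] fun ω => θ.ν * W ω) ∧
        intBeta β J₀ n =ᵐ[P] fun ω => h n ω + D n ω) ∧
      (∀ n : ℕ, max θ.q 1 < n →
        h n =ᵐ[P] fun ω => θ.omegaG + ∑ i ∈ Finset.Icc 1 θ.q, θ.γ i * h (n - i) ω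
          + ∑ i ∈ Finset.Icc 1 (max θ.p θ.q),
              θ.alphaG i * intBeta β J₀ ((n : ℤ) - (i : ℤ)) ω) ∧
      IsMartingaleDifference P F D ∧
      -- (b) moments and conditional expectations
      (InitialMoments θ P β b₀ J₀ ∨ IsStationaryDR θ P β b₀ J₀ →
        (∀ n : ℕ, 1 ≤ n → ∀ r : ℝ≥0,
          MemLp (β (n : ℝ≥0)) r P ∧ MemLp (intBeta β J₀ n) r P) ∧
        (∀ n : ℕ, 1 ≤ n → P[intBeta β J₀ n | F ((n - 1 : ℕ) : ℝ≥0)] =ᵐ[P] h n)) ∧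
      (IsStationaryDR θ P β b₀ J₀ ∨ IsMeanStationaryDR θ P β b₀ J₀ →
        ∀ n : ℕ, 1 ≤ n →
          (Integrable (h n) P ∧
            ∫ ω, h n ω ∂P = θ.omegaG /
              (1 - ∑ i ∈ Finset.Icc 1 θ.q, θ.γ i
                - ∑ j ∈ Finset.Icc 1 (max θ.p θ.q), θ.alphaG j)) ∧
          (Integrable (β (n : ℝ≥0)) P ∧
            ∫ ω, β (n : ℝ≥0) ω ∂P =
              (θ.ω * (1 - ∑ i ∈ Finset.Icc 1 θ.q, θ.γ i
                  - ∑ j ∈ Finset.Icc 1 (max θ.p θ.q), θ.alphaG j)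
                + θ.omegaG * ∑ i ∈ Finset.Icc 1 θ.p, θ.α i) /
              ((1 - ∑ i ∈ Finset.Icc 1 θ.q, θ.γ i
                  - ∑ j ∈ Finset.Icc 1 (max θ.p θ.q), θ.alphaG j)
                * (1 - ∑ i ∈ Finset.Icc 1 θ.q, θ.γ i)))) ∧
      -- (c) uniformly bounded conditional second moments
      (∀ n : ℕ, 1 ≤ n → MemLp (D n) 2 P) ∧
      (∀ᵐ ω ∂P, ∀ n : ℕ, 1 ≤ n →
        (P[fun ω' => D n ω' ^ 2 | F ((n - 1 : ℕ) : ℝ≥0)]) ω ≤ C) := by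
  set G := Real.exp |θ.α 1| with hG
  -- The `+ 1` keeps the constant positive when `ν = 0`.
  refine ⟨θ.ν ^ 2 * G ^ 2 + 1, by positivity, ?_⟩
  intro Ω mΩ P _ F Z β b₀ J₀ hZ hβ
  obtain ⟨J, hJm, hJ⟩ := hβ.exists_version_intBeta
  have hJ' : ∀ᵐ ω ∂P, ∀ k, J k ω = intBeta β J₀ k ω := ae_all_iff.2 hJ
  -- The prediction uses the adapted versions `J`, so `h` and `D = J - h` are exactly measurable for
  -- the required `σ`-algebras; the pathwise identities hold almost surely.
  set h : ℕ → Ω → ℝ := fun n ω =>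
    θ.prediction (fun k => spotBeta β b₀ k ω) (fun k => J k ω) ((n : ℤ) - 1) with hh
  set D : ℕ → Ω → ℝ := fun n ω => J n ω - h n ω with hD
  have hsol := hβ.isSolution hα hZ
  have hhm : ∀ n : ℕ, StronglyMeasurable[F (n : ℝ≥0)] (h (n + 1)) := fun n =>
    (θ.measurable_prediction (fun k h1 h2 => hβ.measurable_spotBeta (n := n)
      (by push_cast at h1; omega) (by push_cast at h2; omega))
      (fun k h1 h2 => hJm k n (by push_cast at h1; omega)
        (by push_cast at h2; omega))).stronglyMeasurable
  have hhae : ∀ᵐ ω ∂P, ∀ n : ℕ, h n ω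
      = θ.prediction (fun k => spotBeta β b₀ k ω) (fun k => intBeta β J₀ k ω) ((n : ℤ) - 1) := by
    filter_upwards [hJ'] with ω hω n
    simp only [hh, hω]
  have hDae : ∀ n, D (n + 1) =ᵐ[P] fun ω => θ.ν * θ.noise Z n ω := by
    intro n
    filter_upwards [hJ', hhae, hsol] with ω h1 h2 h3
    have h4 := h3.int n
    simp only [hD]
    rw [h1, h2, Nat.cast_add, Nat.cast_one, add_sub_cancel_right, h4]
    ring
  have hDmem : ∀ (n : ℕ) (r : ℝ≥0), MemLp (D (n + 1)) r P := fun n r =>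
    ((θ.memLp_noise hZ.brownian r n).const_mul θ.ν).ae_eq (hDae n).symm
  have hDcond : ∀ n : ℕ, P[D (n + 1) | F (n : ℝ≥0)] =ᵐ[P] 0 := by
    intro n
    refine (condExp_congr_ae (hDae n)).trans
      ((condExp_smul θ.ν (θ.noise Z n) (F (n : ℝ≥0))).trans ?_)
    filter_upwards [θ.condExp_noise hα hZ n] with ω hω
    simp [hω]
  have hsplit : ∀ n : ℕ, intBeta β J₀ n =ᵐ[P] fun ω => h n ω + D n ω := by
    intro n
    filter_upwards [hJ n] with ω hω
    simp [hD, hω]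
  have hinit : InitialMoments θ P β b₀ J₀ ∨ IsStationaryDR θ P β b₀ J₀ →
      InitialMoments θ P β b₀ J₀ := by
    rintro (hi | hs)
    · exact hi
    · exact hs.initialMoments hβ hp hα hγ hstab hZ
  refine ⟨h, D, ?_, ?_, ?_, ?_, ?_, ?_, ?_⟩
  · intro n hn
    obtain ⟨n, rfl⟩ : ∃ m, n = m + 1 := ⟨n - 1, by omega⟩
    exact ⟨hhm n, ⟨θ.noise Z n, θ.isWienerIntegral_noise hα hZ n, hDae n⟩, hsplit _⟩
  · intro n hn
    obtain ⟨n, rfl⟩ : ∃ m, n = m + 1 := ⟨n - 1, by omega⟩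
    filter_upwards [hhae, hsol] with ω h1 h2
    have h3 := h2.prediction_eq hp (n := n) (by omega)
    rw [h1, Nat.cast_add, Nat.cast_one, add_sub_cancel_right, h3]
    congr 2
    refine Finset.sum_congr rfl fun i hi => ?_
    rw [h1, show (((n + 1 - i : ℕ) : ℤ) - 1) = n - i by
      have := (Finset.mem_Icc.1 hi).2; omega]
  · intro n hn
    obtain ⟨n, rfl⟩ : ∃ m, n = m + 1 := ⟨n - 1, by omega⟩
    refine ⟨?_, (hDmem n 1).integrable (by simp), hDcond n⟩
    exact (hJm _ _ (by omega) le_rfl).stronglyMeasurable.sub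
      ((hhm n).mono (F.mono (by exact_mod_cast Nat.le_succ n)))
  · intro hor
    have hmom := hβ.memLp_of_initial hα hZ (hinit hor)
    refine ⟨fun n hn r => ⟨?_, (hmom r).2 n (by omega)⟩, fun n hn => ?_⟩
    · rw [← spotBeta_natCast β b₀ n]
      exact (hmom r).1 n (by omega)
    · obtain ⟨n, rfl⟩ : ∃ m, n = m + 1 := ⟨n - 1, by omega⟩
      -- Almost surely `h` is the difference of the integrable variables `Iβ` and `D`.
      have hhint : Integrable (h (n + 1)) P := by
        have h1 := ((hmom 1).2 ((n + 1 : ℕ) : ℤ) (by omega)).hasMean.1.sub (hDmem n 1).hasMean.1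
        refine h1.congr ?_
        filter_upwards [hsplit (n + 1)] with ω hω
        rw [Pi.sub_apply, hω, add_sub_cancel_right]
      refine (condExp_congr_ae (hsplit (n + 1))).trans
        ((condExp_add hhint (hDmem n 1).hasMean.1 _).trans ?_)
      filter_upwards [hDcond n] with ω hω
      rw [Pi.add_apply, Nat.add_sub_cancel, condExp_of_stronglyMeasurable (F.le _) (hhm n) hhint]
      simp [hω]
  · intro hor n hn
    have hmean : HasConstantMeans θ P β b₀ J₀ := by
      rcases hor with hs | hs
      · exact hs.hasConstantMeans hβ hα hZ (hinit (Or.inr hs))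
      · exact hs.hasConstantMeans
    obtain ⟨n, rfl⟩ : ∃ m, n = m + 1 := ⟨n - 1, by omega⟩
    have key := θ.hasMean_of_isSolution hsol (θ.hasMean_noise hα hZ) hp hγ hstab
      (fun k hk => hmean.hasMean_spot hk) (fun k hk h2 => hmean.hasMean_int h2 hk)
    refine ⟨(key n).1.congr ?_, ?_⟩
    · filter_upwards [hhae] with ω hω
      rw [hω, Nat.cast_add, Nat.cast_one, add_sub_cancel_right]
    · rw [← spotBeta_natCast β b₀ (n + 1)]
      exact (key (n + 1)).2
  · intro n hn
    obtain ⟨n, rfl⟩ : ∃ m, n = m + 1 := ⟨n - 1, by omega⟩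
    exact hDmem n 2
  · refine ae_all_iff.2 fun n => ?_
    rcases Nat.eq_zero_or_pos n with rfl | hn
    · exact ae_of_all _ fun ω h0 => absurd h0 (by norm_num)
    obtain ⟨n, rfl⟩ : ∃ m, n = m + 1 := ⟨n - 1, by omega⟩
    have hbound := condExp_le_const_of_setIntegral_le (μ := P) (F.le (n : ℝ≥0))
      (f := fun ω => D (n + 1) ω ^ 2) (hDmem n 2).integrable_sq (c := θ.ν ^ 2 * G ^ 2 + 1) ?_
    · filter_upwards [hbound] with ω hω _ using hω
    · intro A hA
      have h1 : ∫ ω in A, D (n + 1) ω ^ 2 ∂P = θ.ν ^ 2 * ∫ ω in A, θ.noise Z n ω ^ 2 ∂P := by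
        rw [← integral_const_mul]
        refine integral_congr_ae (ae_restrict_of_ae ?_)
        filter_upwards [hDae n] with ω hω
        simp only [hω, mul_pow]
      have h2 := mul_le_mul_of_nonneg_left (θ.setIntegral_noise_sq_le hZ n hA) (sq_nonneg θ.ν)
      rw [h1]
      refine h2.trans ?_
      rw [← hG, ← mul_assoc]
      gcongr
      linarith
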